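/- **Setting.** Let $d\in\mathbb N$ and $\kappa=(\kappa_1,\dots,\kappa_{d+1})\in\mathbb R^{d+1}$ with all $\kappa_i>-1$. Write $(a)_k=a(a+1)\cdots(a+k-1)$, $|\alpha|=\sum_i\alpha_i$, $\alpha!=\prod_i\alpha_i!$, $(\kappa+\mathbf 1)_\alpha=\prod_{i=1}^{d+1}(\kappa_i+1)_{\alpha_i}$ and $\lambda_\kappa=|\kappa|+d+1$. For $N\in\mathbb N_0$ let $\mathbb Z_N^{d+1}=\{x\in\mathbb N_0^{d+1}:|x|=N\}$. Polynomials in $x_1,\dots,x_d$ are evaluated at $x\in\mathbb Z_N^{d+1}$ through the first $d$ coordinates, with $x_{d+1}=N-x_1-\cdots-x_d$, and $$\langle f,g\rangle_{\mathsf H_{\kappa,N}}=\frac{N!}{(\lambda_\kappa)_N}\sum_{x\in\mathbb Z_N^{d+1}}f(x)g(x)\frac{(\kappa+\mathbf 1)_x}{x!}.$$ For $n\le N$ let $\mathcal V_n^d=\mathcal V_n^d(\mathsf H_{\kappa,N})$ be the space of real polynomials in $x_1,\dots,x_d$ of total degree at most $n$ that are orthogonal to all polynomials of total degree at most $n-1$.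 For $\alpha\in\mathbb N_0^{d+1}$ with $n\le|\alpha|\le N$ let $\mathrm m_\alpha(x)=(-1)^{|\alpha|}\prod_{i=1}^{d+1}(-x_i)_{\alpha_i}$, regarded as a polynomial in $x_1,\dots,x_d$ by putting $x_{d+1}=N-x_1-\cdots-x_d$, and let $$\mathsf Q_{\alpha,n}(\cdot;\kappa,N)=\frac1{(\kappa+\mathbf 1)_\alpha}\,\mathrm{proj}_{\mathcal V_n^d(\mathsf H_{\kappa,N})}\mathrm m_\alpha,$$ where $\mathrm{proj}$ is the orthogonal projection with respect to $\langle\cdot,\cdot\rangle_{\mathsf H_{\kappa,N}}$. For $\nu\in\mathbb N_0^d$ with $|\nu|\le N$ put $a_j=\sum_{i=j+1}^{d+1}\kappa_i+2\sum_{i=j+1}^{d}\nu_i+d-j$ and $M_j=N-\sum_{i<j}x_i-\sum_{i=j+1}^d\nu_i$ for $1\le j\le d$, and let $$\mathsf H_\nu(x;\kappa,N)=\frac{(-1)^{|\nu|}}{(-N)_{|\nu|}}\prod_{j=1}^d\frac{(\kappa_j+1)_{\nu_j}}{(a_j+1)_{\nu_j}}\sum_{k=0}^{\nu_j}\frac{(-\nu_j)_k(\nu_j+\kappa_j+a_j+1)_k(-x_j)_k}{(\kappa_j+1)_k\,k!}(-M_j+k)_{\nu_j-k},$$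 $$\mathsf B_\nu(\kappa,N)=\langle\mathsf H_\nu(\cdot;\kappa,N),\mathsf H_\nu(\cdot;\kappa,N)\rangle_{\mathsf H_{\kappa,N}}.$$ (The inner sum is the polynomial form of $(-M_j)_{\nu_j}\,{}_3F_2(-\nu_j,\nu_j+\kappa_j+a_j+1,-x_j;\kappa_j+1,-M_j;1)$.) **Proposition 3.6.** Let $0\le n\le m\le N$. For every $\alpha\in\mathbb Z_m^{d+1}$, $$\mathsf Q_{\alpha,n}(x;\kappa,N)=\frac{(-1)^m(-m)_n(-N)_m(\lambda_\kappa)_{N+n}}{(-N)_n(\lambda_\kappa)_N(\lambda_\kappa)_{m+n}}\sum_{|\nu|=n}\frac{\mathsf H_\nu(\alpha;\kappa,m)}{\mathsf B_\nu(\kappa,N)}\,\mathsf H_\nu(x;\kappa,N).$$ Conversely, for every $\nu\in\mathbb N_0^d$ with $|\nu|=n$, $$\mathsf H_\nu(x;\kappa,N)=\frac{(-1)^m\,m!}{(-N)_m}\sum_{|\alpha|=m}\frac{(\kappa+\mathbf 1)_\alpha}{\alpha!}\,\mathsf H_\nu(\alpha;\kappa,m)\,\mathsf Q_{\alpha,n}(x;\kappa,N).$$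 Both are identities of polynomials in $x_1,\dots,x_d$. In particular, $\{\mathsf Q_{\alpha,n}(\cdot;\kappa,N):|\alpha|=m\}$ spans $\mathcal V_n^d(\mathsf H_{\kappa,N})$. -/

import Mathlib

namespace MultiHahn

open MvPolynomial

noncomputable section

/-- The Pochhammer symbol `(a)_n = a (a + 1) ⋯ (a + n - 1)` in a commutative ring. -/
def poch {R : Type*} [CommRing R] (a : R) (n : ℕ) : R := (ascPochhammer R n).eval a

/-- The multi-indices in `ℕ₀ᵏ` of length `|α| = N`. With `k = d + 1` this is the set of
homogeneous coordinates on which the Hahn weight lives. -/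
def multiIdx (k N : ℕ) : Finset (Fin k → ℕ) := Finset.piAntidiag Finset.univ N

/-- `(κ + 𝟏)_α = ∏ i, (κ_i + 1)_{α_i}`. -/
def kpoch {d : ℕ} (κ : Fin (d + 1) → ℝ) (α : Fin (d + 1) → ℕ) : ℝ :=
  ∏ i, poch (κ i + 1) (α i)

/-- `α! = ∏ i, α_i!`. -/
def mfact {k : ℕ} (α : Fin k → ℕ) : ℝ := ∏ i, ((α i).factorial : ℝ)

/-- `λ_κ = |κ| + d + 1`. -/
def lam {d : ℕ} (κ : Fin (d + 1) → ℝ) : ℝ := (∑ i, κ i) + d + 1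

/-- The value of a polynomial in `x_1, …, x_d` at a point given in homogeneous coordinates
`(x_1, …, x_{d+1})`. -/
def evalAt {d : ℕ} (p : MvPolynomial (Fin d) ℝ) (x : Fin (d + 1) → ℕ) : ℝ :=
  eval (fun i : Fin d => (x i.castSucc : ℝ)) p

/-- The Hahn inner product
`⟨f, g⟩ = N! / (|κ| + d + 1)_N * ∑_{|x| = N} f(x) g(x) (κ + 𝟏)_x / x!`. -/
def hahnInner {d : ℕ} (κ : Fin (d + 1) → ℝ) (N : ℕ) (f g : MvPolynomial (Fin d) ℝ) : ℝ :=
  (N.factorial : ℝ) / poch (lam κ) N *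
    ∑ x ∈ multiIdx (d + 1) N, evalAt f x * evalAt g x * (kpoch κ x / mfact x)

theorem hahnInner_add_left {d : ℕ} (κ : Fin (d + 1) → ℝ) (N : ℕ)
    (f g h : MvPolynomial (Fin d) ℝ) :
    hahnInner κ N (f + g) h = hahnInner κ N f h + hahnInner κ N g h := by
  simp only [hahnInner, evalAt, map_add, add_mul, Finset.sum_add_distrib, mul_add]

theorem hahnInner_smul_left {d : ℕ} (κ : Fin (d + 1) → ℝ) (N : ℕ)
    (c : ℝ) (f h : MvPolynomial (Fin d) ℝ) :
    hahnInner κ N (c • f) h = c * hahnInner κ N f h := by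
  simp only [hahnInner, evalAt, smul_eval, Finset.mul_sum]
  refine Finset.sum_congr rfl fun x _ => ?_
  ring

theorem hahnInner_comm {d : ℕ} (κ : Fin (d + 1) → ℝ) (N : ℕ) (f h : MvPolynomial (Fin d) ℝ) :
    hahnInner κ N f h = hahnInner κ N h f := by
  simp only [hahnInner]
  congr 1
  refine Finset.sum_congr rfl fun x _ => ?_
  ring

/-- The space `𝒱_n^d` of orthogonal polynomials of degree `n` in `d` variables for the Hahn inner
product: polynomials of total degree at most `n` that are orthogonal to all polynomials of total
degree at most `n - 1` (for `n = 0` there is no orthogonality condition). -/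
def orthSpace {d : ℕ} (κ : Fin (d + 1) → ℝ) (N n : ℕ) :
    Submodule ℝ (MvPolynomial (Fin d) ℝ) where
  carrier := {p | p.totalDegree ≤ n ∧
    ∀ q : MvPolynomial (Fin d) ℝ, q.totalDegree < n → hahnInner κ N p q = 0}
  add_mem' := by
    rintro a b ⟨ha, ha'⟩ ⟨hb, hb'⟩
    refine ⟨(totalDegree_add a b).trans (max_le ha hb), fun q hq => ?_⟩
    rw [hahnInner_add_left, ha' q hq, hb' q hq, add_zero]
  zero_mem' := by
    refine ⟨by simp, fun q _ => ?_⟩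
    simp [hahnInner, evalAt]
  smul_mem' := by
    rintro c a ⟨ha, ha'⟩
    refine ⟨(totalDegree_smul_le c a).trans ha, fun q hq => ?_⟩
    rw [hahnInner_smul_left, ha' q hq, mul_zero]

/-- `q` is the orthogonal projection of `p` onto `𝒱_n^d`. -/
def IsOrthProj {d : ℕ} (κ : Fin (d + 1) → ℝ) (N n : ℕ) (p q : MvPolynomial (Fin d) ℝ) : Prop :=
  q ∈ orthSpace κ N n ∧ ∀ v ∈ orthSpace κ N n, hahnInner κ N (p - q) v = 0

open Classical in
/-- The orthogonal projection onto `𝒱_n^d` (it exists and is unique for `κ_i > -1` and `n ≤ N`,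
see `existsUnique_isOrthProj`). -/
def hahnProj {d : ℕ} (κ : Fin (d + 1) → ℝ) (N n : ℕ) (p : MvPolynomial (Fin d) ℝ) :
    MvPolynomial (Fin d) ℝ :=
  if h : ∃ q, IsOrthProj κ N n p q then h.choose else 0

/-- `m_α(x) = (-1)^{|α|} (-x)_α`, a polynomial in the `d + 1` variables `x_1, …, x_{d+1}`. -/
def monicMon {d : ℕ} (α : Fin (d + 1) → ℕ) : MvPolynomial (Fin (d + 1)) ℝ :=
  (-1) ^ (∑ i, α i) * ∏ i, poch (-(X i : MvPolynomial (Fin (d + 1)) ℝ)) (α i)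

/-- Restriction of a polynomial in `d + 1` variables to the hyperplane `x_1 + ⋯ + x_{d+1} = N`,
written as a polynomial in `x_1, …, x_d`. -/
def restrictPlane {d : ℕ} (N : ℕ) (p : MvPolynomial (Fin (d + 1)) ℝ) : MvPolynomial (Fin d) ℝ :=
  aeval (Fin.snoc (α := fun _ => MvPolynomial (Fin d) ℝ) (fun i : Fin d => X i)
    (C (N : ℝ) - ∑ i : Fin d, X i)) p

/-- `Q_{α,n}(·; κ, N) = (1 / (κ + 𝟏)_α) proj_{𝒱_n^d} m_α`. -/
def hahnQ {d : ℕ} (κ : Fin (d + 1) → ℝ) (N : ℕ) (α : Fin (d + 1) → ℕ) (n : ℕ) :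
    MvPolynomial (Fin d) ℝ :=
  (1 / kpoch κ α) • hahnProj κ N n (restrictPlane N (monicMon α))

/-- `|ν^{j+1}| = ν_{j+1} + ⋯ + ν_d`. -/
def tailSum {d : ℕ} (ν : Fin d → ℕ) (j : Fin d) : ℕ := ∑ i ∈ Finset.Ioi j, ν i

/-- `a_j(κ, ν) = |κ^{j+1}| + 2 |ν^{j+1}| + d - j`; the index `j : Fin d` stands for the
one-based index `j + 1`. -/
def aCoef {d : ℕ} (κ : Fin (d + 1) → ℝ) (ν : Fin d → ℕ) (j : Fin d) : ℝ :=
  (∑ i ∈ Finset.Ioi j.castSucc, κ i) + 2 * (tailSum ν j : ℝ) + ((d : ℝ) - ((j : ℕ) + 1))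

/-- The polynomial `(-M)_n 𝖰_n(x; a, b, M)` in `x` and `M`, where
`𝖰_n(x; a, b, M) = ₃F₂(-n, n + a + b + 1, -x; a + 1, -M; 1)` is the classical Hahn polynomial of
one variable. The factor `(-M)_n / (-M)_k = (-M + k)_{n - k}` has been cancelled termwise, so that
the product is a polynomial in `M` as well. -/
def hahnOne {d : ℕ} (n : ℕ) (x : MvPolynomial (Fin d) ℝ) (a b : ℝ) (M : MvPolynomial (Fin d) ℝ) :
    MvPolynomial (Fin d) ℝ :=
  ∑ k ∈ Finset.range (n + 1),
    (poch (-(n : ℝ)) k * poch ((n : ℝ) + a + b + 1) k / (poch (a + 1) k * (k.factorial : ℝ))) •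
      (poch (-x) k * poch (-M + (k : MvPolynomial (Fin d) ℝ)) (n - k))

/-- The Hahn polynomials
`H_ν(x; κ, N) = (-1)^{|ν|} / (-N)_{|ν|} * ∏ j, (κ_j + 1)_{ν_j} / (a_j + 1)_{ν_j} *
  (-M_j)_{ν_j} 𝖰_{ν_j}(x_j; κ_j, a_j, M_j)`, where `M_j = N - |𝐱_{j-1}| - |ν^{j+1}|`. -/
def hahnH {d : ℕ} (κ : Fin (d + 1) → ℝ) (N : ℕ) (ν : Fin d → ℕ) : MvPolynomial (Fin d) ℝ :=
  ((-1) ^ (∑ j, ν j) / poch (-(N : ℝ)) (∑ j, ν j)) •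
    ∏ j : Fin d, (poch (κ j.castSucc + 1) (ν j) / poch (aCoef κ ν j + 1) (ν j)) •
      hahnOne (ν j) (X j) (κ j.castSucc) (aCoef κ ν j)
        (C (N : ℝ) - (∑ i ∈ Finset.Iio j, X i) - C (tailSum ν j : ℝ))

/-- `B_ν(κ, N) = ⟨H_ν(·; κ, N), H_ν(·; κ, N)⟩`. -/
def hahnB {d : ℕ} (κ : Fin (d + 1) → ℝ) (N : ℕ) (ν : Fin d → ℕ) : ℝ :=
  hahnInner κ N (hahnH κ N ν) (hahnH κ N ν)

theorem poch_pos {a : ℝ} (ha : 0 < a) (n : ℕ) : 0 < poch a n := ascPochhammer_pos n a ha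

theorem lam_pos {d : ℕ} {κ : Fin (d + 1) → ℝ} (hκ : ∀ i, -1 < κ i) : 0 < lam κ := by
  have h : 0 < ∑ i, (κ i + 1) :=
    Finset.sum_pos (fun i _ => by linarith [hκ i]) Finset.univ_nonempty
  simp [Finset.sum_add_distrib] at h
  unfold lam
  linarith

/-- A polynomial of degree at most `N` that vanishes on the lattice simplex is zero. -/
theorem eq_zero_of_evalAt {d N : ℕ} {p : MvPolynomial (Fin d) ℝ} (hp : p.totalDegree ≤ N)
    (h : ∀ x ∈ multiIdx (d + 1) N, evalAt p x = 0) : p = 0 := by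
  by_contra hne
  obtain ⟨t, ht, htd⟩ := Finset.exists_mem_eq_sup p.support (support_nonempty.2 hne)
    (fun s => Finsupp.degree s)
  have hdeg : p.totalDegree = t.degree := by
    rw [← htd]; rfl
  obtain ⟨s, hs, hev⟩ := combinatorial_nullstellensatz_exists_eval_nonzero p t
    (mem_support_iff.1 ht) hdeg
    (fun i => (Finset.range (t i + 1)).image (fun k : ℕ => (k : ℝ)))
    (fun i => by rw [Finset.card_image_of_injective _ Nat.cast_injective]; simp)
  have hs' : ∀ i, ∃ k : ℕ, k ≤ t i ∧ (k : ℝ) = s i := fun i => by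
    obtain ⟨k, hk, hk'⟩ := Finset.mem_image.1 (hs i)
    exact ⟨k, Nat.lt_succ_iff.1 (Finset.mem_range.1 hk), hk'⟩
  choose k hk hks using hs'
  have hsum : ∑ i, k i ≤ N := by
    calc ∑ i, k i ≤ ∑ i, t i := Finset.sum_le_sum fun i _ => hk i
      _ = t.degree := (Finsupp.degree_eq_sum t).symm
      _ ≤ N := hdeg ▸ hp
  refine hev ?_
  have := h (Fin.snoc (α := fun _ => ℕ) k (N - ∑ i, k i)) (by
    simp [multiIdx, Finset.mem_piAntidiag, Fin.sum_univ_castSucc]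
    omega)
  simpa [evalAt, hks] using this

theorem eq_zero_of_hahnInner_self {d N : ℕ} {κ : Fin (d + 1) → ℝ} (hκ : ∀ i, -1 < κ i)
    {p : MvPolynomial (Fin d) ℝ} (hp : p.totalDegree ≤ N) (h : hahnInner κ N p p = 0) :
    p = 0 := by
  have hw : ∀ x : Fin (d + 1) → ℕ, 0 < kpoch κ x / mfact x := fun x =>
    div_pos (Finset.prod_pos fun i _ => poch_pos (by linarith [hκ i]) _)
      (Finset.prod_pos fun i _ => by positivity)
  have hc : (N.factorial : ℝ) / poch (lam κ) N ≠ 0 :=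
    (div_pos (by positivity) (poch_pos (lam_pos hκ) N)).ne'
  have hs := (mul_eq_zero.1 h).resolve_left hc
  rw [Finset.sum_eq_zero_iff_of_nonneg
    (fun x _ => mul_nonneg (mul_self_nonneg _) (hw x).le)] at hs
  refine eq_zero_of_evalAt hp fun x hx => ?_
  exact mul_self_eq_zero.1 ((mul_eq_zero.1 (hs x hx)).resolve_right (hw x).ne')

theorem existsUnique_isOrthProj {d N n : ℕ} {κ : Fin (d + 1) → ℝ} (hκ : ∀ i, -1 < κ i)
    (hn : n ≤ N) (p : MvPolynomial (Fin d) ℝ) : ∃! q, IsOrthProj κ N n p q := by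
  let V := orthSpace κ N n
  have hdef : ∀ v ∈ V, hahnInner κ N v v = 0 → v = 0 := fun v hv =>
    eq_zero_of_hahnInner_self hκ (hv.1.trans hn)
  have hle : V ≤ restrictTotalDegree (Fin d) ℝ n := fun v hv =>
    (mem_restrictTotalDegree (Fin d) n v).2 hv.1
  have hfin : FiniteDimensional ℝ (restrictTotalDegree (Fin d) ℝ n) := by
    have hset : {s : Fin d →₀ ℕ | s.degree ≤ n}.Finite := by
      refine (Set.finite_Iic (Finsupp.equivFunOnFinite.symm fun _ : Fin d => n)).subset ?_
      intro s hs i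
      exact (Finsupp.le_degree i s).trans hs
    have : Finite {s : Fin d →₀ ℕ | s.degree ≤ n} := hset
    exact Module.Finite.of_basis (basisRestrictSupport ℝ {s : Fin d →₀ ℕ | s.degree ≤ n})
  have hV : FiniteDimensional ℝ V := Submodule.finiteDimensional_of_le hle
  let B : MvPolynomial (Fin d) ℝ →ₗ[ℝ] MvPolynomial (Fin d) ℝ →ₗ[ℝ] ℝ :=
    LinearMap.mk₂ ℝ (hahnInner κ N) (hahnInner_add_left κ N) (hahnInner_smul_left κ N)
      (fun f g h => by
        rw [hahnInner_comm, hahnInner_add_left, hahnInner_comm κ N g, hahnInner_comm κ N h])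
      (fun c f g => by
        rw [hahnInner_comm, hahnInner_smul_left, hahnInner_comm κ N g]; rfl)
  have hB : ∀ f g, B f g = hahnInner κ N f g := fun _ _ => rfl
  let T : V →ₗ[ℝ] Module.Dual ℝ V := (B.compl₂ V.subtype).comp V.subtype
  have hT : ∀ v w : V, T v w = hahnInner κ N v w := fun _ _ => rfl
  have hinj : Function.Injective T := by
    rw [injective_iff_map_eq_zero]
    intro v hv
    refine Subtype.ext (hdef v v.2 ?_)
    rw [← hT, hv]; rfl
  have hsurj : Function.Surjective T :=
    (LinearMap.injective_iff_surjective_of_finrank_eq_finrank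
      (Subspace.dual_finrank_eq (K := ℝ) (V := V)).symm).1 hinj
  obtain ⟨q, hq⟩ := hsurj ((B p).comp V.subtype)
  have hq' : ∀ v ∈ V, B q v = B p v := fun v hv => LinearMap.congr_fun hq ⟨v, hv⟩
  refine ⟨q, ⟨q.2, fun v hv => ?_⟩, ?_⟩
  · rw [← hB, map_sub, LinearMap.sub_apply, hq' v hv, sub_self]
  · rintro r ⟨hr, hr'⟩
    have hmem : r - q ∈ V := V.sub_mem hr q.2
    refine sub_eq_zero.1 (hdef _ hmem ?_)
    have h1 := hr' _ hmem
    rw [← hB, LinearMap.map_sub₂] at h1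
    rw [← hB, LinearMap.map_sub₂, hq' _ hmem]
    linarith

theorem hahnProj_spec {d N n : ℕ} {κ : Fin (d + 1) → ℝ} (hκ : ∀ i, -1 < κ i)
    (hn : n ≤ N) (p : MvPolynomial (Fin d) ℝ) : IsOrthProj κ N n p (hahnProj κ N n p) := by
  have h : ∃ q, IsOrthProj κ N n p q := (existsUnique_isOrthProj hκ hn p).exists
  rw [hahnProj, dif_pos h]
  exact h.choose_spec

end

end MultiHahn

open MultiHahn

/-! Two operators link functions on the simplices of sizes `N` and `m`: `lowerOp`, which amounts to
pairing with the `m_α`, and `raiseOp`, which sums the `m_α` against values at the points `α`. They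
are adjoint for the unnormalised Hahn weights (`sum_lowerOp_mul`), since both have the kernel
`m_α(x)`. By Chu–Vandermonde each is diagonal, with eigenvalue depending only on the degree, on a
graded basis of shifted factorials (`lowerOp_riseBasis`, `raiseOp_fallBasis`). Hence each multiplies
the top component of a polynomial by an explicit scalar and preserves lower degrees; by adjointness
each also preserves orthogonality to lower degrees.

An element of `𝒱_n^d` with `n ≤ N` is determined by its component of degree `n`
(`eq_of_mem_orthSpace`), and the top components of `H_ν(·; κ, N)` and `H_ν(·; κ, m)` are
proportional (`hahnH_sub_smul_mem`). So the operators carry one Hahn polynomial to an explicit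
multiple of the other (`lowerOp_hahnH`, `raiseOp_hahnH`).

The first identity is the expansion of `Q_{α,n}` in the orthogonal basis `H_ν`: its Fourier
coefficients are values at `α` of `lowerOp` applied to `H_ν(·; κ, N)`. The second holds because its
right-hand sum is the projection of `raiseOp` applied to `H_ν(·; κ, m)`, which already lies in
`𝒱_n^d`. Spanning follows.

That the `H_ν` form an orthogonal basis is proved separately, by summing out one variable at a time
(`exists_sum_prodVal_monomial`, `sum_prodVal_mul_prodVal_of_ne`) and counting dimensions
(`exists_eq_sum_hahnH`). -/

namespace MultiHahn

open MvPolynomial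
open Finset.HasAntidiagonal (antidiagonal mem_antidiagonal)

noncomputable section

/-! ### Pochhammer symbols and the Chu–Vandermonde identity. -/

section Pochhammer

variable {R S : Type*} [CommRing R] [CommRing S]

@[simp] theorem poch_zero (a : R) : poch a 0 = 1 := by simp [poch]

theorem poch_succ (a : R) (n : ℕ) : poch a (n + 1) = poch a n * (a + n) :=
  ascPochhammer_succ_eval n a

theorem poch_succ_left (a : R) (n : ℕ) : poch a (n + 1) = a * poch (a + 1) n := by
  simp [poch, ascPochhammer_succ_left, Polynomial.eval_comp]

theorem poch_add (a : R) (m n : ℕ) : poch a (m + n) = poch a m * poch (a + m) n := by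
  induction n with
  | zero => simp
  | succ n ih =>
    rw [← add_assoc, poch_succ, poch_succ, ih]
    push_cast
    ring

theorem map_poch (f : R →+* S) (a : R) (n : ℕ) : f (poch a n) = poch (f a) n := by
  induction n with
  | zero => simp
  | succ n ih => simp [poch_succ, ih]

theorem poch_neg_natCast_eq_zero {x n : ℕ} (h : x < n) : poch (-(x : R)) n = 0 := by
  obtain ⟨k, rfl⟩ : ∃ k, n = x + (k + 1) := ⟨n - x - 1, by omega⟩
  rw [poch_add, poch_succ_left]
  simp

theorem poch_one_natCast (n : ℕ) : poch (1 : R) n = (n.factorial : R) := by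
  induction n with
  | zero => simp
  | succ n ih => rw [poch_succ, ih, Nat.factorial_succ]; push_cast; ring

theorem poch_reflect (a : R) (n : ℕ) : poch (-a) n = (-1) ^ n * poch (a - n + 1) n := by
  induction n generalizing a with
  | zero => simp
  | succ n ih =>
    rw [poch_succ, ih, poch_succ_left, pow_succ]
    have h1 : a - ((n + 1 : ℕ) : R) + 1 + 1 = a - n + 1 := by push_cast; ring
    rw [h1]
    push_cast
    ring

theorem neg_one_pow_mul_poch_neg {x n : ℕ} (h : n ≤ x) :
    (-1) ^ n * poch (-(x : ℝ)) n = (x.factorial : ℝ) / ((x - n).factorial : ℝ) := by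
  obtain ⟨k, rfl⟩ := Nat.exists_eq_add_of_le h
  rw [poch_reflect, ← mul_assoc, ← mul_pow, neg_one_mul, neg_neg, one_pow, one_mul,
    Nat.add_sub_cancel_left, eq_div_iff (by positivity)]
  have h1 : ((n + k : ℕ) : ℝ) - n + 1 = 1 + k := by push_cast; ring
  rw [h1, ← poch_one_natCast (R := ℝ) k, ← poch_one_natCast (R := ℝ) (n + k), add_comm n k,
    poch_add, mul_comm]

theorem poch_neg_natCast_ne_zero {x n : ℕ} (h : n ≤ x) : poch (-(x : ℝ)) n ≠ 0 := by
  intro h0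
  have := neg_one_pow_mul_poch_neg h
  rw [h0, mul_zero] at this
  have h2 : (x.factorial : ℝ) / ((x - n).factorial : ℝ) ≠ 0 := by positivity
  exact h2 this.symm

/-- Chu–Vandermonde: since `(c)_k / k!` is `(-1)^k` times the binomial coefficient of `-c` over `k`,
this is the addition formula for generalised binomial coefficients. -/
theorem sum_antidiagonal_poch (a b : ℝ) (n : ℕ) :
    ∑ p ∈ antidiagonal n,
      poch a p.1 / (p.1.factorial : ℝ) * (poch b p.2 / (p.2.factorial : ℝ)) =
      poch (a + b) n / (n.factorial : ℝ) := by
  have key : ∀ (c : ℝ) (k : ℕ), poch c k / (k.factorial : ℝ) = (-1) ^ k * Ring.choose (-c) k := by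
    intro c k
    have h := Ring.descPochhammer_eq_factorial_smul_choose (-c) k
    rw [Polynomial.descPochhammer_smeval_eq_ascPochhammer, Polynomial.ascPochhammer_smeval_eq_eval,
      nsmul_eq_mul] at h
    have hk : (k.factorial : ℝ) ≠ 0 := by positivity
    have h2 := poch_reflect (-c) k
    rw [neg_neg] at h2
    rw [div_eq_iff hk, h2, poch, h]
    ring
  rw [key, neg_add, Ring.add_choose_eq n (Commute.all _ _), Finset.mul_sum]
  refine Finset.sum_congr rfl fun p hp => ?_
  rw [key, key, ← mem_antidiagonal.1 hp, pow_add]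
  ring

end Pochhammer

/-! ### Sums over lattice simplices. -/

section MultiIndex

theorem mem_multiIdx {k N : ℕ} {x : Fin k → ℕ} : x ∈ multiIdx k N ↔ ∑ i, x i = N := by
  simp [multiIdx]

theorem sum_multiIdx_succ {M : Type*} [AddCommMonoid M] (k N : ℕ) (F : (Fin (k + 1) → ℕ) → M) :
    ∑ x ∈ multiIdx (k + 1) N, F x =
      ∑ p ∈ antidiagonal N, ∑ x ∈ multiIdx k p.2,
        F (Fin.cons (α := fun _ => ℕ) p.1 x) := by
  rw [Finset.sum_sigma']
  refine Finset.sum_bij' (fun x _ => ⟨(x 0, ∑ i : Fin k, x i.succ), Fin.tail x⟩)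
    (fun p _ => Fin.cons (α := fun _ => ℕ) p.1.1 p.2) ?_ ?_ ?_ ?_ ?_
  · intro x hx
    rw [mem_multiIdx, Fin.sum_univ_succ] at hx
    simp [mem_multiIdx, Fin.tail, hx]
  · rintro ⟨⟨a, b⟩, x⟩ hx
    simp [mem_multiIdx] at hx ⊢
    simp [hx.1, hx.2]
  · intro x hx
    simp
  · rintro ⟨⟨a, b⟩, x⟩ hx
    simp [mem_multiIdx] at hx ⊢
    simp [hx.2]
  · intro x hx
    simp

theorem multiIdx_one (N : ℕ) : multiIdx 1 N = {fun _ => N} := by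
  ext x
  simp [mem_multiIdx, funext_iff]

theorem sum_multiIdx_poch (k : ℕ) (c : Fin k → ℝ) (N : ℕ) :
    ∑ y ∈ multiIdx k N, (∏ i, poch (c i) (y i)) / mfact y =
      poch (∑ i, c i) N / (N.factorial : ℝ) := by
  induction k generalizing N with
  | zero =>
    rcases N with _ | N
    · simp [multiIdx, mfact]
    · rw [multiIdx, Finset.univ_eq_empty, Finset.piAntidiag_empty_of_ne_zero (by omega)]
      simp [poch_succ_left]
  | succ k ih =>
    rw [sum_multiIdx_succ, Fin.sum_univ_succ, ← sum_antidiagonal_poch]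
    refine Finset.sum_congr rfl fun p _ => ?_
    rw [← ih, Finset.mul_sum]
    refine Finset.sum_congr rfl fun y _ => ?_
    rw [mfact, mfact, Fin.prod_univ_succ, Fin.prod_univ_succ]
    simp only [Fin.cons_zero, Fin.cons_succ]
    rw [mul_div_mul_comm]

/-- The value `m_α(x) = ∏ i, (-1)^{α_i} (-x_i)_{α_i}`. -/
def fallVal {k : ℕ} (α x : Fin k → ℕ) : ℝ := ∏ i, ((-1) ^ α i * poch (-(x i : ℝ)) (α i))

theorem kpoch_pos {d : ℕ} {κ : Fin (d + 1) → ℝ} (hκ : ∀ i, -1 < κ i) (α : Fin (d + 1) → ℕ) :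
    0 < kpoch κ α :=
  Finset.prod_pos fun i _ => poch_pos (by linarith [hκ i]) _

theorem fallVal_eq_zero {k : ℕ} {α x : Fin k → ℕ} (h : ¬ α ≤ x) : fallVal α x = 0 := by
  simp only [Pi.le_def, not_forall, not_le] at h
  obtain ⟨i, hi⟩ := h
  exact Finset.prod_eq_zero (Finset.mem_univ i) (by rw [poch_neg_natCast_eq_zero hi, mul_zero])

theorem fallVal_add {k : ℕ} (α y : Fin k → ℕ) :
    fallVal α (α + y) / mfact (α + y) = 1 / mfact y := by
  rw [fallVal, mfact, mfact, ← Finset.prod_div_distrib, one_div, ← Finset.prod_inv_distrib]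
  refine Finset.prod_congr rfl fun i _ => ?_
  rw [Pi.add_apply, neg_one_pow_mul_poch_neg (by omega), Nat.add_sub_cancel_left]
  field_simp

/-- The factor `m_α(x)` vanishes unless `α ≤ x`, so only the points `x = α + y` survive, and there
`m_α(x) / x! = 1 / y!`. -/
theorem sum_fallVal_shift {k N m : ℕ} (hm : m ≤ N) {α : Fin k → ℕ} (hα : α ∈ multiIdx k m)
    (F : (Fin k → ℕ) → ℝ) :
    ∑ x ∈ multiIdx k N, F x * (fallVal α x / mfact x) =
      ∑ y ∈ multiIdx k (N - m), F (α + y) / mfact y := by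
  rw [mem_multiIdx] at hα
  symm
  refine Finset.sum_of_injOn (fun y => α + y) (fun a _ b _ h => add_left_cancel h) ?_ ?_ ?_
  · intro y hy
    simp only [Finset.mem_coe, mem_multiIdx] at hy ⊢
    simp [Finset.sum_add_distrib, hα, hy]
    omega
  · intro x hx hx'
    rw [fallVal_eq_zero, zero_div, mul_zero]
    intro hle
    refine hx' ⟨x - α, ?_, ?_⟩
    · simp only [Finset.mem_coe, mem_multiIdx] at hx ⊢
      have : ∑ i, α i + ∑ i, (x - α) i = ∑ i, x i := by
        rw [← Finset.sum_add_distrib]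
        exact Finset.sum_congr rfl fun i _ => add_tsub_cancel_of_le (hle i)
      omega
    · exact add_tsub_cancel_of_le hle
  · intro y _
    rw [fallVal_add]
    ring

theorem kpoch_add {d : ℕ} (κ : Fin (d + 1) → ℝ) (α y : Fin (d + 1) → ℕ) :
    kpoch κ (α + y) = kpoch κ α * ∏ i, poch (κ i + 1 + α i) (y i) := by
  rw [kpoch, kpoch, ← Finset.prod_mul_distrib]
  exact Finset.prod_congr rfl fun i _ => by rw [Pi.add_apply, poch_add]

end MultiIndex

/-! ### The degree filtration and equality of top components. -/

section Filtration

variable {σ : Type*}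

/-- Polynomials of total degree less than `n`. -/
def degLT (σ : Type*) (n : ℕ) : Submodule ℝ (MvPolynomial σ ℝ) where
  carrier := {p | ∀ s : σ →₀ ℕ, n ≤ s.degree → coeff s p = 0}
  add_mem' := fun ha hb s hs => by rw [coeff_add, ha s hs, hb s hs, add_zero]
  zero_mem' := fun s _ => coeff_zero s
  smul_mem' := fun c p hp s hs => by rw [coeff_smul, hp s hs, smul_zero]

theorem degLT_mono {m n : ℕ} (h : m ≤ n) : degLT σ m ≤ degLT σ n :=
  fun _ hp s hs => hp s (h.trans hs)

theorem mem_degLT_succ {n : ℕ} {p : MvPolynomial σ ℝ} :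
    p ∈ degLT σ (n + 1) ↔ p.totalDegree ≤ n := by
  constructor
  · intro h
    refine Finset.sup_le fun s hs => ?_
    by_contra hlt
    exact mem_support_iff.1 hs (h s (not_le.1 hlt))
  · intro h s hs
    exact coeff_eq_zero_of_totalDegree_lt (lt_of_le_of_lt h hs)

theorem mem_degLT_zero {p : MvPolynomial σ ℝ} : p ∈ degLT σ 0 ↔ p = 0 := by
  constructor
  · intro h
    ext s
    rw [h s (Nat.zero_le _), coeff_zero]
  · rintro rfl
    exact Submodule.zero_mem _

theorem mem_degLT_of_totalDegree_lt {n : ℕ} {p : MvPolynomial σ ℝ} (h : p.totalDegree < n) :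
    p ∈ degLT σ n := by
  obtain ⟨k, rfl⟩ : ∃ k, n = k + 1 := ⟨n - 1, by omega⟩
  exact mem_degLT_succ.2 (Nat.lt_succ_iff.1 h)

/-- The zero polynomial has `totalDegree` equal to `0`, so it must be split off when `n = 0`. -/
theorem eq_zero_or_totalDegree_lt {n : ℕ} {p : MvPolynomial σ ℝ} (h : p ∈ degLT σ n) :
    p = 0 ∨ p.totalDegree < n := by
  rcases n with _ | n
  · exact Or.inl (mem_degLT_zero.1 h)
  · exact Or.inr (Nat.lt_succ_of_le (mem_degLT_succ.1 h))

theorem mul_mem_degLT {i j : ℕ} {p q : MvPolynomial σ ℝ} (hp : p ∈ degLT σ (i + 1))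
    (hq : q ∈ degLT σ j) : p * q ∈ degLT σ (i + j) := by
  classical
  intro s hs
  rw [coeff_mul]
  refine Finset.sum_eq_zero fun u hu => ?_
  have hsum : u.1.degree + u.2.degree = s.degree := by
    rw [← Finset.HasAntidiagonal.mem_antidiagonal.1 hu, map_add]
  by_cases h : i + 1 ≤ u.1.degree
  · rw [hp _ h, zero_mul]
  · rw [hq _ (by omega), mul_zero]

theorem monomial_mem_degLT {n : ℕ} {s : σ →₀ ℕ} (hs : s.degree < n) (c : ℝ) :
    monomial s c ∈ degLT σ n := by
  classical
  intro t ht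
  rw [coeff_monomial, if_neg]
  rintro rfl
  omega

/-- Both polynomials have degree at most `n`, and they have the same component of degree `n`. -/
def TopEq (n : ℕ) (p q : MvPolynomial σ ℝ) : Prop :=
  p ∈ degLT σ (n + 1) ∧ q ∈ degLT σ (n + 1) ∧ p - q ∈ degLT σ n

namespace TopEq

theorem refl {n : ℕ} {p : MvPolynomial σ ℝ} (hp : p ∈ degLT σ (n + 1)) : TopEq n p p :=
  ⟨hp, hp, by rw [sub_self]; exact Submodule.zero_mem _⟩

theorem mul {i j : ℕ} {p p' q q' : MvPolynomial σ ℝ} (hp : TopEq i p p') (hq : TopEq j q q') :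
    TopEq (i + j) (p * q) (p' * q') := by
  refine ⟨mul_mem_degLT (j := j + 1) hp.1 hq.1, mul_mem_degLT (j := j + 1) hp.2.1 hq.2.1, ?_⟩
  have h : p * q - p' * q' = p * (q - q') + q' * (p - p') := by ring
  rw [h]
  refine Submodule.add_mem _ (mul_mem_degLT hp.1 hq.2.2) ?_
  rw [add_comm i j]
  exact mul_mem_degLT hq.2.1 hp.2.2

theorem smul {n : ℕ} {p q : MvPolynomial σ ℝ} (h : TopEq n p q) (c : ℝ) :
    TopEq n (c • p) (c • q) :=
  ⟨Submodule.smul_mem _ _ h.1, Submodule.smul_mem _ _ h.2.1, by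
    rw [← smul_sub]; exact Submodule.smul_mem _ _ h.2.2⟩

theorem sum {ι : Type*} {s : Finset ι} {n : ℕ} {p q : ι → MvPolynomial σ ℝ}
    (h : ∀ i ∈ s, TopEq n (p i) (q i)) : TopEq n (∑ i ∈ s, p i) (∑ i ∈ s, q i) :=
  ⟨Submodule.sum_mem _ fun i hi => (h i hi).1, Submodule.sum_mem _ fun i hi => (h i hi).2.1, by
    rw [← Finset.sum_sub_distrib]
    exact Submodule.sum_mem _ fun i hi => (h i hi).2.2⟩

theorem one : TopEq 0 (1 : MvPolynomial σ ℝ) 1 :=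
  refl (mem_degLT_succ.2 (by simp))

theorem prod {ι : Type*} {s : Finset ι} {n : ι → ℕ} {p q : ι → MvPolynomial σ ℝ}
    (h : ∀ i ∈ s, TopEq (n i) (p i) (q i)) :
    TopEq (∑ i ∈ s, n i) (∏ i ∈ s, p i) (∏ i ∈ s, q i) := by
  classical
  induction s using Finset.induction_on with
  | empty => simpa using one
  | insert a s ha ih =>
    rw [Finset.sum_insert ha, Finset.prod_insert ha, Finset.prod_insert ha]
    exact (h a (Finset.mem_insert_self _ _)).mul
      (ih fun i hi => h i (Finset.mem_insert_of_mem hi))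

theorem add_const {p : MvPolynomial σ ℝ} (hp : p ∈ degLT σ 2) (a b : ℝ) :
    TopEq 1 (p + C a) (p + C b) := by
  have hC : ∀ c : ℝ, (C c : MvPolynomial σ ℝ) ∈ degLT σ 1 := fun c =>
    mem_degLT_succ.2 (by simp)
  have hC' : ∀ c : ℝ, (C c : MvPolynomial σ ℝ) ∈ degLT σ 2 := fun c =>
    degLT_mono (by norm_num) (hC c)
  refine ⟨Submodule.add_mem _ hp (hC' a), Submodule.add_mem _ hp (hC' b), ?_⟩
  rw [add_sub_add_left_eq_sub]
  exact Submodule.sub_mem _ (hC a) (hC b)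

theorem poch {p : MvPolynomial σ ℝ} (hp : p ∈ degLT σ 2) (a b : ℝ) (n : ℕ) :
    TopEq n (poch (p + C a) n) (poch (p + C b) n) := by
  induction n with
  | zero => simpa using one
  | succ n ih =>
    rw [poch_succ, poch_succ]
    refine ih.mul ?_
    have := add_const hp (a + n) (b + n)
    rwa [C_add, C_add, ← add_assoc, ← add_assoc, map_natCast] at this

theorem poch_pow {p : MvPolynomial σ ℝ} (hp : p ∈ degLT σ 2) (a : ℝ) (n : ℕ) :
    TopEq n (MultiHahn.poch (p + C a) n) (p ^ n) := by
  induction n with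
  | zero => simpa using one
  | succ n ih =>
    rw [poch_succ, pow_succ]
    refine ih.mul ?_
    have := add_const hp (a + n) 0
    rwa [C_add, C_0, add_zero, ← add_assoc, map_natCast] at this

end TopEq

theorem X_mem_degLT (i : σ) : (X i : MvPolynomial σ ℝ) ∈ degLT σ 2 :=
  mem_degLT_succ.2 (totalDegree_X i).le

/-- A pair of linear maps that is diagonal on a graded basis acts on the top component of a
polynomial of degree `k` as multiplication by the `k`-th eigenvalue. -/
theorem exists_of_diagonal {W : Type*} [AddCommGroup W] [Module ℝ W]
    (A B : MvPolynomial σ ℝ →ₗ[ℝ] W) (e : (σ →₀ ℕ) → MvPolynomial σ ℝ) (c : ℕ → ℝ) {n : ℕ}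
    (he : ∀ s, monomial s 1 - e s ∈ degLT σ s.degree)
    (hAB : ∀ s, s.degree ≤ n → A (e s) = c s.degree • B (e s)) {k : ℕ} (hk : k ≤ n)
    {p : MvPolynomial σ ℝ} (hp : p ∈ degLT σ (k + 1)) :
    ∃ r ∈ degLT σ k, A p = B (c k • p + r) := by
  classical
  induction k using Nat.strong_induction_on generalizing p with
  | _ k ih =>
    -- The combination of basis elements with the same component of degree `k` as `p`; on it `A` is
    -- exactly `c k • B`.
    let q := ∑ s ∈ p.support.filter (fun s => s.degree = k), coeff s p • e s
    have hq : p - q ∈ degLT σ k := by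
      have h1 : p - q = ∑ s ∈ p.support,
          (monomial s (coeff s p) - if s.degree = k then coeff s p • e s else 0) := by
        rw [Finset.sum_sub_distrib, ← p.as_sum, ← Finset.sum_filter]
      rw [h1]
      refine Submodule.sum_mem _ fun s hs => ?_
      split_ifs with h
      · have h2 : (monomial s (coeff s p) : MvPolynomial σ ℝ) - coeff s p • e s =
            coeff s p • (monomial s 1 - e s) := by
          rw [smul_sub, smul_monomial, smul_eq_mul, mul_one]
        rw [h2, ← h]
        exact Submodule.smul_mem _ _ (he s)
      · rw [sub_zero]
        refine monomial_mem_degLT (lt_of_le_of_ne ?_ h) _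
        by_contra hlt
        exact mem_support_iff.1 hs (hp s (not_le.1 hlt))
    have hAq : A q = c k • B q := by
      simp only [q, map_sum, map_smul, Finset.smul_sum]
      refine Finset.sum_congr rfl fun s hs => ?_
      have hs' := (Finset.mem_filter.1 hs).2
      rw [hAB s (hs'.trans_le hk), hs', smul_comm]
    obtain ⟨r, hr, hAr⟩ : ∃ r ∈ degLT σ k, A (p - q) = B r := by
      rcases k with _ | k
      · exact ⟨0, Submodule.zero_mem _, by rw [mem_degLT_zero.1 hq, map_zero, map_zero]⟩
      · obtain ⟨r, hr, h⟩ := ih k (Nat.lt_succ_self k) (by omega) hq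
        exact ⟨_, Submodule.add_mem _ (Submodule.smul_mem _ (c k) hq)
          (degLT_mono (Nat.le_succ k) hr), h⟩
    -- Replacing `c k • q` by `c k • p` costs `c k • (p - q)`, which has degree below `k`.
    refine ⟨r - c k • (p - q), Submodule.sub_mem _ hr (Submodule.smul_mem _ _ hq), ?_⟩
    have hp' : A p = A q + A (p - q) := by rw [← map_add, add_sub_cancel]
    rw [hp', hAq, hAr, ← map_smul, ← map_add]
    congr 1
    rw [smul_sub]
    abel

end Filtration

/-! ### The lowering and raising operators between simplices. -/

section Operators

variable {d : ℕ}

/-- Evaluation at a point in homogeneous coordinates, as a linear map. -/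
def evalLin (x : Fin (d + 1) → ℕ) : MvPolynomial (Fin d) ℝ →ₗ[ℝ] ℝ where
  toFun p := evalAt p x
  map_add' p q := by simp [evalAt]
  map_smul' c p := by simp [evalAt, smul_eval]

theorem evalLin_apply (x : Fin (d + 1) → ℕ) (p : MvPolynomial (Fin d) ℝ) :
    evalLin x p = evalAt p x := rfl

/-- Restriction of a polynomial to the lattice simplex. -/
def latticeEval (d N : ℕ) :
    MvPolynomial (Fin d) ℝ →ₗ[ℝ] ({x // x ∈ multiIdx (d + 1) N} → ℝ) :=
  LinearMap.pi fun x => evalLin x.1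

/-- The operator `f ↦ ∑_{|y| = N - m} f(· + y) (κ + 1 + ·)_y / y!` from functions on the simplex of
size `N` to functions on the simplex of size `m`. -/
def lowerOp (κ : Fin (d + 1) → ℝ) (m N : ℕ) :
    MvPolynomial (Fin d) ℝ →ₗ[ℝ] ({x // x ∈ multiIdx (d + 1) m} → ℝ) :=
  LinearMap.pi fun α => ∑ y ∈ multiIdx (d + 1) (N - m),
    ((∏ i, poch (κ i + 1 + α.1 i) (y i)) / mfact y) • evalLin (α.1 + y)

/-- The operator `h ↦ ∑_{|α| = m} h(α) m_α / α!` from functions on the simplex of size `m` to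
functions on the simplex of size `N`. -/
def raiseOp (d m N : ℕ) :
    MvPolynomial (Fin d) ℝ →ₗ[ℝ] ({x // x ∈ multiIdx (d + 1) N} → ℝ) :=
  LinearMap.pi fun x => ∑ α ∈ multiIdx (d + 1) m, (fallVal α x.1 / mfact α) • evalLin α

theorem latticeEval_apply {N : ℕ} (p : MvPolynomial (Fin d) ℝ)
    (x : {x // x ∈ multiIdx (d + 1) N}) : latticeEval d N p x = evalAt p x.1 := rfl

theorem lowerOp_apply (κ : Fin (d + 1) → ℝ) (m N : ℕ) (p : MvPolynomial (Fin d) ℝ)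
    (α : {x // x ∈ multiIdx (d + 1) m}) :
    lowerOp κ m N p α = ∑ y ∈ multiIdx (d + 1) (N - m),
      (∏ i, poch (κ i + 1 + α.1 i) (y i)) / mfact y * evalAt p (α.1 + y) := by
  simp [lowerOp, evalLin_apply]

theorem raiseOp_apply (m N : ℕ) (p : MvPolynomial (Fin d) ℝ)
    (x : {x // x ∈ multiIdx (d + 1) N}) :
    raiseOp d m N p x = ∑ α ∈ multiIdx (d + 1) m, fallVal α x.1 / mfact α * evalAt p α := by
  simp [raiseOp, evalLin_apply]

/-- Extension of a multi-index by zero. -/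
def extIdx (s : Fin d →₀ ℕ) : Fin (d + 1) → ℕ := Fin.snoc (α := fun _ => ℕ) s 0

@[simp] theorem extIdx_castSucc (s : Fin d →₀ ℕ) (i : Fin d) : extIdx s i.castSucc = s i := by
  simp [extIdx]

@[simp] theorem extIdx_last (s : Fin d →₀ ℕ) : extIdx s (Fin.last d) = 0 := by
  simp [extIdx]

theorem extIdx_mem (s : Fin d →₀ ℕ) : extIdx s ∈ multiIdx (d + 1) s.degree := by
  rw [mem_multiIdx, Fin.sum_univ_castSucc, Finsupp.degree_eq_sum]
  simp

theorem monomial_one_eq_prod (s : Fin d →₀ ℕ) :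
    (monomial s 1 : MvPolynomial (Fin d) ℝ) = ∏ i, X i ^ s i := by
  rw [monomial_eq, C_1, one_mul, Finsupp.prod_fintype _ _ fun i => pow_zero _]

/-- The basis `∏ (κ_i + 1 + x_i)_{s_i}` of polynomials. -/
def riseBasis (κ : Fin (d + 1) → ℝ) (s : Fin d →₀ ℕ) : MvPolynomial (Fin d) ℝ :=
  ∏ i, poch (X i + C (κ i.castSucc + 1)) (s i)

/-- The basis `∏ (-1)^{s_i} (-x_i)_{s_i}` of polynomials. -/
def fallBasis (s : Fin d →₀ ℕ) : MvPolynomial (Fin d) ℝ :=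
  ∏ i, ((-1 : ℝ) ^ s i • poch (-X i + C 0) (s i))

theorem TopEq.sub_mem {σ : Type*} {n : ℕ} {p q : MvPolynomial σ ℝ} (h : TopEq n p q) :
    q - p ∈ degLT σ n := by
  rw [← neg_sub]
  exact Submodule.neg_mem _ h.2.2

theorem riseBasis_top (κ : Fin (d + 1) → ℝ) (s : Fin d →₀ ℕ) :
    monomial s 1 - riseBasis κ s ∈ degLT (Fin d) s.degree := by
  rw [monomial_one_eq_prod, riseBasis, Finsupp.degree_eq_sum]
  exact (TopEq.prod fun i _ => TopEq.poch_pow (X_mem_degLT i) _ _).sub_mem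

theorem fallBasis_top (s : Fin d →₀ ℕ) :
    monomial s 1 - fallBasis s ∈ degLT (Fin d) s.degree := by
  rw [monomial_one_eq_prod, fallBasis, Finsupp.degree_eq_sum]
  refine (TopEq.prod fun i _ => ?_).sub_mem
  have h := (TopEq.poch_pow (Submodule.neg_mem _ (X_mem_degLT i)) 0 (s i)).smul ((-1 : ℝ) ^ s i)
  have h2 : ((-1 : ℝ) ^ s i) • (-X i : MvPolynomial (Fin d) ℝ) ^ s i = X i ^ s i := by
    rw [← smul_pow]
    simp
  rwa [h2] at h

theorem evalAt_riseBasis (κ : Fin (d + 1) → ℝ) (s : Fin d →₀ ℕ) (x : Fin (d + 1) → ℕ) :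
    evalAt (riseBasis κ s) x = ∏ i, poch (κ i + 1 + x i) (extIdx s i) := by
  rw [Fin.prod_univ_castSucc]
  simp only [evalAt, riseBasis, map_prod, map_poch, map_add, eval_X, eval_C, extIdx_castSucc,
    extIdx_last, poch_zero, mul_one]
  exact Finset.prod_congr rfl fun i _ => by rw [add_comm (x _ : ℝ)]

theorem evalAt_fallBasis (s : Fin d →₀ ℕ) (x : Fin (d + 1) → ℕ) :
    evalAt (fallBasis s) x = fallVal (extIdx s) x := by
  rw [fallVal, Fin.prod_univ_castSucc]
  simp [evalAt, fallBasis, map_prod, smul_eval, map_poch]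

/-- With `c = κ_i + 1 + α_i`, both `(c)_y (c + y)_s` and `(c)_s (c + s)_y` equal `(c)_{y+s}`. This
pulls the basis element out of the sum over `y`, and the rest is a Vandermonde sum whose parameters
add up to `λ_κ + m + |s|`. -/
theorem lowerOp_riseBasis (κ : Fin (d + 1) → ℝ) (m N : ℕ) (s : Fin d →₀ ℕ) :
    lowerOp κ m N (riseBasis κ s) =
      (poch (lam κ + m + s.degree) (N - m) / ((N - m).factorial : ℝ)) •
        latticeEval d m (riseBasis κ s) := by
  ext ⟨α, hα⟩
  rw [lowerOp_apply, Pi.smul_apply, latticeEval_apply, smul_eq_mul]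
  have hc : ∑ i, (κ i + 1 + α i + extIdx s i) = lam κ + m + s.degree := by
    rw [mem_multiIdx] at hα
    have hs := mem_multiIdx.1 (extIdx_mem s)
    rw [Finset.sum_add_distrib, Finset.sum_add_distrib, Finset.sum_add_distrib, ← hα, ← hs, lam]
    push_cast
    simp
    ring
  rw [← hc, ← sum_multiIdx_poch, Finset.sum_mul]
  refine Finset.sum_congr rfl fun y _ => ?_
  rw [evalAt_riseBasis, evalAt_riseBasis, div_mul_eq_mul_div, div_mul_eq_mul_div,
    ← Finset.prod_mul_distrib, ← Finset.prod_mul_distrib]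
  congr 1
  refine Finset.prod_congr rfl fun i _ => ?_
  rw [Pi.add_apply, Nat.cast_add, ← add_assoc, ← poch_add, add_comm (y i), poch_add, mul_comm]

theorem fallVal_add_left {k : ℕ} (a y x : Fin k → ℕ) :
    fallVal (a + y) x =
      fallVal a x * ((-1) ^ (∑ i, y i) * ∏ i, poch (-(x i : ℝ) + a i) (y i)) := by
  rw [fallVal, fallVal, ← Finset.prod_pow_eq_pow_sum, ← Finset.prod_mul_distrib,
    ← Finset.prod_mul_distrib]
  refine Finset.prod_congr rfl fun i _ => ?_
  rw [Pi.add_apply, poch_add, pow_add]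
  ring

/-- The basis element is itself some `m_s`, so the sum over `α` restricts to `α = s + y`; then
`m_{s+y}(x)` factors as `m_s(x)` times shifted factorials in `y`, summed by Vandermonde. -/
theorem raiseOp_fallBasis {m : ℕ} (N : ℕ) {s : Fin d →₀ ℕ} (hs : s.degree ≤ m) :
    raiseOp d m N (fallBasis s) =
      ((-1) ^ (m - s.degree) * poch (-(N : ℝ) + s.degree) (m - s.degree) /
        ((m - s.degree).factorial : ℝ)) • latticeEval d N (fallBasis s) := by
  ext ⟨x, hx⟩
  rw [raiseOp_apply, Pi.smul_apply, latticeEval_apply, smul_eq_mul]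
  simp only [evalAt_fallBasis]
  have h1 := sum_fallVal_shift hs (extIdx_mem s) fun α => fallVal α x
  have h2 : ∀ α : Fin (d + 1) → ℕ, fallVal α x / mfact α * fallVal (extIdx s) α =
      fallVal α x * (fallVal (extIdx s) α / mfact α) := fun α => by ring
  simp only [h2]
  rw [h1]
  have hc : ∑ i, (-(x i : ℝ) + extIdx s i) = -(N : ℝ) + s.degree := by
    rw [mem_multiIdx] at hx
    have hs := mem_multiIdx.1 (extIdx_mem s)
    rw [Finset.sum_add_distrib, Finset.sum_neg_distrib, ← hx, ← hs]
    push_cast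
    ring
  rw [mul_div_assoc, ← hc, ← sum_multiIdx_poch, Finset.mul_sum, Finset.sum_mul]
  refine Finset.sum_congr rfl fun y hy => ?_
  rw [fallVal_add_left, mem_multiIdx.1 hy]
  ring

theorem exists_lowerOp (κ : Fin (d + 1) → ℝ) (m N : ℕ) {k : ℕ} {p : MvPolynomial (Fin d) ℝ}
    (hp : p ∈ degLT (Fin d) (k + 1)) :
    ∃ r ∈ degLT (Fin d) k, lowerOp κ m N p = latticeEval d m
      ((poch (lam κ + m + k) (N - m) / ((N - m).factorial : ℝ)) • p + r) :=
  exists_of_diagonal (lowerOp κ m N) (latticeEval d m) (riseBasis κ)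
    (fun k => poch (lam κ + m + k) (N - m) / ((N - m).factorial : ℝ)) (riseBasis_top κ)
    (fun s _ => lowerOp_riseBasis κ m N s) le_rfl hp

theorem exists_raiseOp {m : ℕ} (N : ℕ) {k : ℕ} (hk : k ≤ m) {p : MvPolynomial (Fin d) ℝ}
    (hp : p ∈ degLT (Fin d) (k + 1)) :
    ∃ r ∈ degLT (Fin d) k, raiseOp d m N p = latticeEval d N
      (((-1) ^ (m - k) * poch (-(N : ℝ) + k) (m - k) / ((m - k).factorial : ℝ)) • p + r) :=
  exists_of_diagonal (raiseOp d m N) (latticeEval d N) fallBasis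
    (fun k => (-1) ^ (m - k) * poch (-(N : ℝ) + k) (m - k) / ((m - k).factorial : ℝ))
    fallBasis_top (fun _ hs => raiseOp_fallBasis N hs) hk hp

/-- Shifting `x = α + y` and splitting `(κ + 𝟏)_{α+y}` turns the pairing with `m_α` into a value of
`lowerOp`; this is how the Fourier coefficients of `Q_{α,n}` are computed. -/
theorem sum_mul_fallVal_eq_lowerOp (κ : Fin (d + 1) → ℝ) {m N : ℕ} (hm : m ≤ N)
    (q : MvPolynomial (Fin d) ℝ) (α : {x // x ∈ multiIdx (d + 1) m}) :
    ∑ x ∈ multiIdx (d + 1) N, evalAt q x * fallVal α.1 x * (kpoch κ x / mfact x) =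
      kpoch κ α.1 * lowerOp κ m N q α := by
  have h := sum_fallVal_shift hm α.2 fun x => evalAt q x * kpoch κ x
  rw [lowerOp_apply, Finset.mul_sum]
  have h1 : ∀ x : Fin (d + 1) → ℕ, evalAt q x * fallVal α.1 x * (kpoch κ x / mfact x) =
      evalAt q x * kpoch κ x * (fallVal α.1 x / mfact x) := fun x => by ring
  simp only [h1, h, kpoch_add]
  exact Finset.sum_congr rfl fun y _ => by ring

/-- Adjointness: both sides are the double sum with kernel `m_α(x) / α!`, with the order of
summation exchanged. -/
theorem sum_lowerOp_mul (κ : Fin (d + 1) → ℝ) {m N : ℕ} (hm : m ≤ N)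
    (q h : MvPolynomial (Fin d) ℝ) :
    ∑ α : {x // x ∈ multiIdx (d + 1) m},
      lowerOp κ m N q α * evalAt h α.1 * (kpoch κ α.1 / mfact α.1) =
    ∑ x : {x // x ∈ multiIdx (d + 1) N},
      evalAt q x.1 * raiseOp d m N h x * (kpoch κ x.1 / mfact x.1) := by
  have h1 : ∀ α : {x // x ∈ multiIdx (d + 1) m},
      lowerOp κ m N q α * evalAt h α.1 * (kpoch κ α.1 / mfact α.1) =
      ∑ x : {x // x ∈ multiIdx (d + 1) N}, evalAt h α.1 / mfact α.1 *
        (evalAt q x.1 * fallVal α.1 x.1 * (kpoch κ x.1 / mfact x.1)) := by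
    intro α
    rw [← Finset.mul_sum, Finset.sum_coe_sort (multiIdx (d + 1) N)
      (fun x => evalAt q x * fallVal α.1 x * (kpoch κ x / mfact x)),
      sum_mul_fallVal_eq_lowerOp κ hm]
    ring
  rw [Finset.sum_congr rfl fun α _ => h1 α, Finset.sum_comm]
  refine Finset.sum_congr rfl fun x _ => ?_
  rw [raiseOp_apply, ← Finset.sum_coe_sort (multiIdx (d + 1) m), Finset.mul_sum, Finset.sum_mul]
  refine Finset.sum_congr rfl fun α _ => ?_
  ring

end Operators

/-! ### One-variable Hahn polynomials and their moments. -/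

section OneVariable

/-- The values of `hahnOne`. -/
def hOne (n : ℕ) (x a b M : ℝ) : ℝ :=
  ∑ k ∈ Finset.range (n + 1),
    (poch (-(n : ℝ)) k * poch ((n : ℝ) + a + b + 1) k / (poch (a + 1) k * (k.factorial : ℝ))) *
      (poch (-x) k * poch (-M + k) (n - k))

/-- `(c)_{N - n} / (N - n)!`, extended by zero to `N < n`. -/
def shiftWeight (c : ℝ) (n N : ℕ) : ℝ :=
  if n ≤ N then poch c (N - n) / ((N - n).factorial : ℝ) else 0

theorem sum_antidiagonal_shift_fst {k N : ℕ} (hk : k ≤ N) {F : ℕ × ℕ → ℝ}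
    (hF : ∀ p : ℕ × ℕ, p.1 < k → F p = 0) :
    ∑ p ∈ antidiagonal N, F p = ∑ p ∈ antidiagonal (N - k), F (k + p.1, p.2) := by
  symm
  refine Finset.sum_of_injOn (fun p : ℕ × ℕ => (k + p.1, p.2)) ?_ ?_ ?_ ?_
  · rintro ⟨a, b⟩ _ ⟨a', b'⟩ _ h
    simpa using h
  · rintro ⟨a, b⟩ h
    simp only [Finset.mem_coe, mem_antidiagonal] at h ⊢
    omega
  · rintro ⟨a, b⟩ h h'
    refine hF _ ?_
    by_contra hlt
    simp only [not_lt] at hlt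
    refine h' ⟨(a - k, b), ?_, ?_⟩
    · simp only [Finset.mem_coe, mem_antidiagonal] at h ⊢
      omega
    · simp only [Prod.mk.injEq, and_true]
      omega
  · intro p _
    rfl

theorem sum_antidiagonal_shift_snd {k N : ℕ} (hk : k ≤ N) {F : ℕ × ℕ → ℝ}
    (hF : ∀ p : ℕ × ℕ, p.2 < k → F p = 0) :
    ∑ p ∈ antidiagonal N, F p = ∑ p ∈ antidiagonal (N - k), F (p.1, k + p.2) := by
  rw [← Finset.Nat.sum_antidiagonal_swap,
    sum_antidiagonal_shift_fst hk (F := fun p => F p.swap) fun p hp => hF _ hp,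
    ← Finset.Nat.sum_antidiagonal_swap]
  rfl

/-- The factor `(-x)_k` forces `x = k + x'` and raises the first parameter by `k`; `(b + y)_j`
raises the second by `j`. What remains is Vandermonde. -/
theorem sum_antidiagonal_poch_mul (a b : ℝ) (j k M : ℕ) :
    ∑ p ∈ antidiagonal M, poch a p.1 / (p.1.factorial : ℝ) * (poch b p.2 / (p.2.factorial : ℝ)) *
        (poch (-(p.1 : ℝ)) k * poch (b + p.2) j) =
      (-1) ^ k * poch a k * poch b j * shiftWeight (a + b + j + k) k M := by
  rw [shiftWeight]
  split_ifs with hk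
  · rw [sum_antidiagonal_shift_fst hk]
    · have hc : a + b + j + k = (a + k) + (b + j) := by ring
      rw [hc, ← sum_antidiagonal_poch, Finset.mul_sum]
      refine Finset.sum_congr rfl fun p _ => ?_
      have h1 := neg_one_pow_mul_poch_neg (x := k + p.1) (n := k) (by omega)
      rw [Nat.add_sub_cancel_left] at h1
      have h2 : poch (-((k + p.1 : ℕ) : ℝ)) k =
          (-1) ^ k * (((k + p.1).factorial : ℝ) / (p.1.factorial : ℝ)) := by
        rw [← h1, ← mul_assoc, ← mul_pow, neg_one_mul, neg_neg, one_pow, one_mul]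
      have h3 : poch b p.2 * poch (b + p.2) j = poch b j * poch (b + j) p.2 := by
        rw [← poch_add, ← poch_add, add_comm]
      dsimp only
      rw [h2, poch_add a k p.1]
      have e : ∀ u v w f g h z : ℝ, f ≠ 0 → g ≠ 0 → h ≠ 0 →
          u * v / f * (w / g) * ((-1) ^ k * (f / h) * z) =
            (-1) ^ k * u * (w * z) * (v / h / g) := by
        intro u v w f g h z hf hg hh
        field_simp
      rw [e _ _ _ _ _ _ _ (by positivity) (by positivity) (by positivity), h3]
      ring
    · intro p hp
      rw [poch_neg_natCast_eq_zero hp]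
      ring
  · rw [mul_zero]
    refine Finset.sum_eq_zero fun p hp => ?_
    have := mem_antidiagonal.1 hp
    rw [poch_neg_natCast_eq_zero (by omega)]
    ring

/-- Up to sign, this is the `n`-th forward difference of `P` at `0`. -/
theorem sum_alternating_choose_eval (P : Polynomial ℝ) {n : ℕ} (hP : P.natDegree < n) :
    ∑ k ∈ Finset.range (n + 1), (-1) ^ k * (n.choose k : ℝ) * P.eval (k : ℝ) = 0 := by
  have h := congrFun (Polynomial.fwdDiff_iter_eq_zero_of_degree_lt hP) (0 : ℝ)
  rw [fwdDiff_iter_eq_sum_shift, Pi.zero_apply] at h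
  have h2 := congrArg (fun t => (-1 : ℝ) ^ n * t) h
  simp only [mul_zero, Finset.mul_sum] at h2
  rw [← h2]
  refine Finset.sum_congr rfl fun k hk => ?_
  have hk' : k ≤ n := Nat.lt_succ_iff.1 (Finset.mem_range.1 hk)
  obtain ⟨l, rfl⟩ := Nat.exists_eq_add_of_le hk'
  simp only [Nat.add_sub_cancel_left, zsmul_eq_mul, nsmul_eq_mul, mul_one, zero_add]
  push_cast
  have : (-1 : ℝ) ^ (k + l) * (-1) ^ l = (-1) ^ k := by
    rw [pow_add, mul_assoc, ← mul_pow]; simp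
  rw [← mul_assoc, ← mul_assoc, this]

theorem poch_neg_self_div_factorial (n k : ℕ) (hk : k ≤ n) :
    poch (-(n : ℝ)) k / (k.factorial : ℝ) = (-1) ^ k * (n.choose k : ℝ) := by
  have h := neg_one_pow_mul_poch_neg hk
  rw [Nat.cast_choose ℝ hk]
  have h2 : poch (-(n : ℝ)) k = (-1) ^ k * ((n.factorial : ℝ) / ((n - k).factorial : ℝ)) := by
    rw [← h, ← mul_assoc, ← mul_pow, neg_one_mul, neg_neg, one_pow, one_mul]
  rw [h2]
  field_simp

/-- Writing `n - 1 = j + l`, the ratio of Pochhammer symbols equals `(c + j + k)_l / (c + j)_l`, a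
polynomial in `k` of degree `l < n`, which the `n`-th difference kills. -/
theorem sum_vandermonde_eq_zero {c : ℝ} (hc : 0 < c) {n j : ℕ} (hj : j < n) :
    ∑ k ∈ Finset.range (n + 1),
      poch (-(n : ℝ)) k / (k.factorial : ℝ) * (poch (n + c - 1) k / poch (c + j) k) = 0 := by
  obtain ⟨l, rfl⟩ : ∃ l, n = j + l + 1 := ⟨n - j - 1, by omega⟩
  have hP := sum_alternating_choose_eval (n := j + l + 1)
    ((ascPochhammer ℝ l).comp (Polynomial.X + Polynomial.C (c + j))) (by
      rw [Polynomial.natDegree_comp, ascPochhammer_natDegree, Polynomial.natDegree_X_add_C]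
      omega)
  have h2 := congrArg (fun t => t / poch (c + j) l) hP
  simp only [zero_div, Finset.sum_div] at h2
  rw [← h2]
  refine Finset.sum_congr rfl fun k hk => ?_
  rw [poch_neg_self_div_factorial _ _ (Nat.lt_succ_iff.1 (Finset.mem_range.1 hk)), mul_div_assoc]
  congr 1
  have hcj : 0 < c + j := by positivity
  rw [Polynomial.eval_comp, div_eq_div_iff (poch_pos hcj k).ne' (poch_pos hcj l).ne']
  have e1 : ((j + l + 1 : ℕ) : ℝ) + c - 1 = c + j + l := by push_cast; ring
  simp only [Polynomial.eval_add, Polynomial.eval_X, Polynomial.eval_C]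
  change _ = poch ((k : ℝ) + (c + j)) l * _
  rw [e1, mul_comm, ← poch_add, add_comm (k : ℝ), mul_comm, ← poch_add, add_comm l k]

/-- Functions `f(x, M - x)` whose pairing with the one-variable Hahn polynomial is the shifted
weight times a polynomial in `M` of degree at most `D - n`. -/
def goodFun (n : ℕ) (a b : ℝ) (D : ℕ) : Submodule ℝ (ℕ → ℕ → ℝ) where
  carrier := {f | ∃ p ∈ Polynomial.degreeLT ℝ (D + 1 - n), ∀ M : ℕ,
    ∑ q ∈ antidiagonal M, poch (a + 1) q.1 / (q.1.factorial : ℝ) *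
      (poch (b + 1) q.2 / (q.2.factorial : ℝ)) * (hOne n q.1 a b M * f q.1 q.2) =
    shiftWeight (a + b + 2 + 2 * n) n M * p.eval (M : ℝ)}
  add_mem' := by
    rintro f g ⟨p, hp, hfp⟩ ⟨q, hq, hgq⟩
    refine ⟨p + q, Submodule.add_mem _ hp hq, fun M => ?_⟩
    rw [Polynomial.eval_add, mul_add, ← hfp, ← hgq, ← Finset.sum_add_distrib]
    refine Finset.sum_congr rfl fun i _ => ?_
    simp only [Pi.add_apply]
    ring
  zero_mem' := ⟨0, Submodule.zero_mem _, fun M => by simp⟩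
  smul_mem' := by
    rintro c f ⟨p, hp, hfp⟩
    refine ⟨c • p, Submodule.smul_mem _ _ hp, fun M => ?_⟩
    rw [Polynomial.eval_smul, smul_eq_mul, mul_left_comm, ← hfp, Finset.mul_sum]
    refine Finset.sum_congr rfl fun i _ => ?_
    simp only [Pi.smul_apply, smul_eq_mul]
    ring

theorem goodFun_mono (n : ℕ) (a b : ℝ) {D E : ℕ} (h : D ≤ E) :
    goodFun n a b D ≤ goodFun n a b E := by
  rintro f ⟨p, hp, hfp⟩
  exact ⟨p, Polynomial.degreeLT_mono (by omega) hp, hfp⟩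

/-- On the summation range `x + y = M` is constant, so the polynomial in `M` is merely multiplied by
its variable. -/
theorem goodFun_sum_mul (n : ℕ) (a b : ℝ) {D : ℕ} {f : ℕ → ℕ → ℝ} (hf : f ∈ goodFun n a b D) :
    (fun x y : ℕ => ((x : ℝ) + y) * f x y) ∈ goodFun n a b (D + 1) := by
  obtain ⟨p, hp, hfp⟩ := hf
  refine ⟨p * Polynomial.X, ?_, fun M => ?_⟩
  · rw [Polynomial.mem_degreeLT] at hp ⊢
    by_cases h0 : p = 0
    · rw [h0, zero_mul, Polynomial.degree_zero]
      exact WithBot.bot_lt_coe _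
    · rw [Polynomial.degree_mul_X, Polynomial.degree_eq_natDegree h0] at *
      have : p.natDegree < D + 1 - n := by exact_mod_cast hp
      have : p.natDegree + 1 < D + 1 + 1 - n := by omega
      exact_mod_cast this
  · rw [Polynomial.eval_mul, Polynomial.eval_X, ← mul_assoc, ← hfp, Finset.sum_mul]
    refine Finset.sum_congr rfl fun i hi => ?_
    rw [← mem_antidiagonal.1 hi]
    push_cast
    ring

/-- Test functions `(b + 1 + y)_j` only shift the weight, so each term of the ₃F₂ can be summed; a
sum over `k` independent of `M` remains. -/
theorem sum_hOne_poch (n : ℕ) {a b : ℝ} (ha : -1 < a) (hb : -1 < b) (j M : ℕ) :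
    ∑ q ∈ antidiagonal M, poch (a + 1) q.1 / (q.1.factorial : ℝ) *
      (poch (b + 1) q.2 / (q.2.factorial : ℝ)) * (hOne n q.1 a b M * poch (b + 1 + q.2) j) =
    if n ≤ M then (-1) ^ n * poch (b + 1) j * poch (a + b + 2 + j) M / ((M - n).factorial : ℝ) *
      ∑ k ∈ Finset.range (n + 1), poch (-(n : ℝ)) k / (k.factorial : ℝ) *
        (poch (n + (a + b + 2) - 1) k / poch (a + b + 2 + j) k) else 0 := by
  have h1 : ∀ q ∈ antidiagonal M, poch (a + 1) q.1 / (q.1.factorial : ℝ) *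
      (poch (b + 1) q.2 / (q.2.factorial : ℝ)) * (hOne n q.1 a b M * poch (b + 1 + q.2) j) =
      ∑ k ∈ Finset.range (n + 1),
        poch (-(n : ℝ)) k * poch ((n : ℝ) + a + b + 1) k / (poch (a + 1) k * (k.factorial : ℝ)) *
        poch (-(M : ℝ) + k) (n - k) *
        (poch (a + 1) q.1 / (q.1.factorial : ℝ) * (poch (b + 1) q.2 / (q.2.factorial : ℝ)) *
        (poch (-(q.1 : ℝ)) k * poch (b + 1 + q.2) j)) := by
    intro q _
    rw [hOne, Finset.sum_mul, Finset.mul_sum]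
    exact Finset.sum_congr rfl fun k _ => by ring
  rw [Finset.sum_congr rfl h1, Finset.sum_comm]
  simp only [← Finset.mul_sum, sum_antidiagonal_poch_mul]
  have hpoch : ∀ k, k ≤ M → poch (-(M : ℝ) + k) (n - k) = poch (-((M - k : ℕ) : ℝ)) (n - k) := by
    intro k hk
    rw [Nat.cast_sub hk]
    ring_nf
  split_ifs with hM
  · rw [Finset.mul_sum]
    refine Finset.sum_congr rfl fun k hk => ?_
    have hkn : k ≤ n := Nat.lt_succ_iff.1 (Finset.mem_range.1 hk)
    have hkM := hkn.trans hM
    have h2 := neg_one_pow_mul_poch_neg (x := M - k) (n := n - k) (by omega)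
    have h3 : poch (-((M - k : ℕ) : ℝ)) (n - k) =
        (-1) ^ (n - k) * (((M - k).factorial : ℝ) / ((M - n).factorial : ℝ)) := by
      have : M - k - (n - k) = M - n := by omega
      rw [this] at h2
      rw [← h2, ← mul_assoc, ← mul_pow, neg_one_mul, neg_neg, one_pow, one_mul]
    have hs : (-1 : ℝ) ^ (n - k) * (-1) ^ k = (-1) ^ n := by
      rw [← pow_add, Nat.sub_add_cancel hkn]
    rw [hpoch k hkM, h3, shiftWeight, if_pos hkM, ← hs]
    have hM' : poch (a + b + 2 + j) M =
        poch (a + b + 2 + j) k * poch (a + 1 + (b + 1) + j + k) (M - k) := by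
      obtain ⟨l, rfl⟩ := Nat.exists_eq_add_of_le hkM
      rw [poch_add, Nat.add_sub_cancel_left]
      congr 2
      ring
    have hn' : (n : ℝ) + (a + b + 2) - 1 = n + a + b + 1 := by ring
    rw [hM', hn']
    have hak : poch (a + 1) k ≠ 0 := (poch_pos (by linarith) k).ne'
    have hck : poch (a + b + 2 + j) k ≠ 0 := (poch_pos (by
      have : (0 : ℝ) ≤ j := Nat.cast_nonneg j
      linarith) k).ne'
    field_simp
  · refine Finset.sum_eq_zero fun k hk => ?_
    have hkn : k ≤ n := Nat.lt_succ_iff.1 (Finset.mem_range.1 hk)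
    by_cases hkM : k ≤ M
    · rw [hpoch k hkM, poch_neg_natCast_eq_zero (x := M - k) (n := n - k) (by omega)]
      ring
    · rw [shiftWeight, if_neg hkM]
      ring

theorem poch_mem_goodFun (n : ℕ) {a b : ℝ} (ha : -1 < a) (hb : -1 < b) (j : ℕ) :
    (fun _ y : ℕ => poch (b + 1 + y) j) ∈ goodFun n a b j := by
  have hc : 0 < a + b + 2 := by linarith
  by_cases hj : j < n
  · refine ⟨0, Submodule.zero_mem _, fun M => ?_⟩
    rw [sum_hOne_poch n ha hb, sum_vandermonde_eq_zero hc hj]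
    simp
  · obtain ⟨l, rfl⟩ := Nat.exists_eq_add_of_le (not_lt.1 hj)
    set E := ∑ k ∈ Finset.range (n + 1), poch (-(n : ℝ)) k / (k.factorial : ℝ) *
        (poch (n + (a + b + 2) - 1) k / poch (a + b + 2 + (n + l : ℕ)) k) with hE
    -- With `c = a + b + 2` and `j = n + l`, the witness comes from `(c + j)_M = (c + j)_n (c +
    -- 2n)_{M-n} (M + c + n)_l / (c + 2n)_l`; the middle factor goes into the shifted weight.
    refine ⟨Polynomial.C ((-1) ^ n * poch (b + 1) (n + l) * E *
      (poch (a + b + 2 + (n + l : ℕ)) n / poch (a + b + 2 + 2 * n) l)) *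
      (ascPochhammer ℝ l).comp (Polynomial.X + Polynomial.C (a + b + 2 + n)), ?_, fun M => ?_⟩
    · rw [Polynomial.mem_degreeLT]
      refine lt_of_le_of_lt Polynomial.degree_le_natDegree ?_
      refine lt_of_le_of_lt (Nat.cast_le.2 (Polynomial.natDegree_C_mul_le _ _)) ?_
      rw [Polynomial.natDegree_comp, ascPochhammer_natDegree, Polynomial.natDegree_X_add_C]
      have : l * 1 < n + l + 1 - n := by omega
      exact_mod_cast this
    · rw [sum_hOne_poch n ha hb, ← hE, shiftWeight]
      split_ifs with hM
      · obtain ⟨t, rfl⟩ := Nat.exists_eq_add_of_le hM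
        rw [Nat.add_sub_cancel_left, Polynomial.eval_mul, Polynomial.eval_C, Polynomial.eval_comp]
        simp only [Polynomial.eval_add, Polynomial.eval_X, Polynomial.eval_C]
        change _ = _ * (_ * poch _ l)
        have hl : poch (a + b + 2 + 2 * n) l ≠ 0 := (poch_pos (by positivity) l).ne'
        have h1 := poch_add (a + b + 2 + (n + l : ℕ)) n t
        have h2 := poch_add (a + b + 2 + 2 * n) l t
        have h3 := poch_add (a + b + 2 + 2 * n) t l
        have e1 : a + b + 2 + ((n + l : ℕ) : ℝ) + n = a + b + 2 + 2 * n + l := by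
          push_cast; ring
        have e2 : ((n + t : ℕ) : ℝ) + (a + b + 2 + n) = a + b + 2 + 2 * n + t := by
          push_cast; ring
        rw [e1] at h1
        rw [e2, h1]
        rw [add_comm l t, h3] at h2
        field_simp
        linear_combination (-(E * poch (b + 1) (n + l) * poch (a + b + 2 + (n + l : ℕ)) n)) * h2
      · rw [zero_mul]

/-- A factor `y + t` is absorbed by raising `j`, up to a constant multiple of the old function; a
factor `x` is written as `(x + y) - y`. -/
theorem monomial_mem_goodFun (n : ℕ) {a b : ℝ} (ha : -1 < a) (hb : -1 < b) (t : ℝ) (k e j : ℕ) :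
    (fun x y : ℕ => (x : ℝ) ^ k * (((y : ℝ) + t) ^ e * poch (b + 1 + y) j)) ∈
      goodFun n a b (k + e + j) := by
  induction k generalizing e j with
  | zero =>
    induction e generalizing j with
    | zero => simpa using poch_mem_goodFun n ha hb j
    | succ e ih =>
      have h1 := ih (j + 1)
      have h2 := (goodFun n a b _).smul_mem (t - (b + 1 + j)) (ih j)
      have h3 := (goodFun n a b (0 + (e + 1) + j)).add_mem
        (goodFun_mono n a b (by omega) h1) (goodFun_mono n a b (by omega) h2)
      convert h3 using 1
      funext x y
      simp only [Pi.add_apply, Pi.smul_apply, smul_eq_mul, poch_succ]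
      ring
  | succ k ih =>
    have h1 := goodFun_sum_mul n a b (ih e j)
    have h2 := ih e (j + 1)
    have h3 := (goodFun n a b _).smul_mem (b + 1 + j) (ih e j)
    have h4 := (goodFun n a b (k + 1 + e + j)).add_mem
      ((goodFun n a b (k + 1 + e + j)).sub_mem
        (goodFun_mono n a b (by omega) h1) (goodFun_mono n a b (by omega) h2))
      (goodFun_mono n a b (by omega) h3)
    convert h4 using 1
    funext x y
    simp only [Pi.add_apply, Pi.sub_apply, Pi.smul_apply, smul_eq_mul, poch_succ]
    ring

theorem polynomial_mem_goodFun (n : ℕ) {a b : ℝ} (ha : -1 < a) (hb : -1 < b) (t : ℝ) (k E : ℕ)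
    {p : Polynomial ℝ} (hp : p ∈ Polynomial.degreeLT ℝ (E + 1)) :
    (fun x y : ℕ => (x : ℝ) ^ k * p.eval ((y : ℝ) + t)) ∈ goodFun n a b (k + E) := by
  have hdeg : p.natDegree < E + 1 := by
    by_cases h0 : p = 0
    · simp [h0]
    · rw [Polynomial.mem_degreeLT, Polynomial.degree_eq_natDegree h0] at hp
      exact_mod_cast hp
  have h : (fun (x : ℕ) (y : ℕ) => (x : ℝ) ^ k * p.eval ((y : ℝ) + t)) =
      ∑ e ∈ Finset.range (E + 1), p.coeff e •
        (fun (x : ℕ) (y : ℕ) => (x : ℝ) ^ k * (((y : ℝ) + t) ^ e * poch (b + 1 + y) 0)) := by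
    funext x y
    rw [Polynomial.eval_eq_sum_range' hdeg, Finset.mul_sum]
    simp only [Finset.sum_apply, Pi.smul_apply, smul_eq_mul, poch_zero]
    exact Finset.sum_congr rfl fun i _ => by ring
  rw [h]
  refine Submodule.sum_mem _ fun e he => Submodule.smul_mem _ _ ?_
  have := Finset.mem_range.1 he
  exact goodFun_mono n a b (by omega) (monomial_mem_goodFun n ha hb t k e 0)

end OneVariable

/-! ### Summing out the first variable, and orthogonality of the products. -/

section Peeling

/-- The product of one-variable polynomials in the definition of `hahnH`, without constants. -/
def hahnProd {d : ℕ} (κ : Fin (d + 1) → ℝ) (N : ℝ) (ν : Fin d → ℕ) : MvPolynomial (Fin d) ℝ :=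
  ∏ j : Fin d, hahnOne (ν j) (X j) (κ j.castSucc) (aCoef κ ν j)
    (C N - (∑ i ∈ Finset.Iio j, X i) - C (tailSum ν j : ℝ))

/-- The values of `hahnProd`. -/
def prodVal {d : ℕ} (κ : Fin (d + 1) → ℝ) (N : ℝ) (ν : Fin d → ℕ) (x : Fin (d + 1) → ℕ) : ℝ :=
  ∏ j : Fin d, hOne (ν j) (x j.castSucc) (κ j.castSucc) (aCoef κ ν j)
    (N - (∑ i ∈ Finset.Iio j, (x i.castSucc : ℝ)) - (tailSum ν j : ℝ))

theorem evalAt_hahnProd {d : ℕ} (κ : Fin (d + 1) → ℝ) (N : ℝ) (ν : Fin d → ℕ)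
    (x : Fin (d + 1) → ℕ) : evalAt (hahnProd κ N ν) x = prodVal κ N ν x := by
  simp only [evalAt, hahnProd, prodVal, map_prod, hahnOne, hOne, map_sum, smul_eval, map_mul,
    map_poch, map_neg, map_add, map_sub, eval_X, eval_C, map_natCast]

theorem sum_Ioi_zero {M : Type*} [AddCommMonoid M] {k : ℕ} (f : Fin (k + 1) → M) :
    ∑ i ∈ Finset.Ioi (0 : Fin (k + 1)), f i = ∑ i : Fin k, f i.succ := by
  rw [Fin.Ioi_zero_eq_map, Finset.sum_map]
  rfl

theorem sum_Ioi_succ {M : Type*} [AddCommMonoid M] {k : ℕ} (f : Fin (k + 1) → M) (j : Fin k) :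
    ∑ i ∈ Finset.Ioi j.succ, f i = ∑ i ∈ Finset.Ioi j, f i.succ := by
  rw [← Fin.map_succEmb_Ioi, Finset.sum_map]
  rfl

theorem sum_Iio_succ {M : Type*} [AddCommMonoid M] {k : ℕ} (f : Fin (k + 1) → M) (j : Fin k) :
    ∑ i ∈ Finset.Iio j.succ, f i = f 0 + ∑ i ∈ Finset.Iio j, f i.succ := by
  have h : Finset.Iio j.succ = insert 0 ((Finset.Iio j).map (Fin.succEmb k)) := by
    rw [Fin.map_succEmb_Iio]
    ext i
    rcases Fin.eq_zero_or_eq_succ i with rfl | ⟨i, rfl⟩ <;> simp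
  rw [h, Finset.sum_insert (by simp), Finset.sum_map]
  rfl

variable {d : ℕ}

theorem tailSum_zero (ν : Fin (d + 1) → ℕ) : tailSum ν 0 = ∑ i, Fin.tail ν i :=
  sum_Ioi_zero ν

theorem tailSum_succ (ν : Fin (d + 1) → ℕ) (j : Fin d) :
    tailSum ν j.succ = tailSum (Fin.tail ν) j :=
  sum_Ioi_succ ν j

theorem aCoef_zero (κ : Fin (d + 2) → ℝ) (ν : Fin (d + 1) → ℕ) :
    aCoef κ ν 0 + 1 = lam (Fin.tail κ) + 2 * ((∑ i, Fin.tail ν i : ℕ) : ℝ) := by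
  rw [aCoef, tailSum_zero, Fin.castSucc_zero, sum_Ioi_zero, lam]
  simp only [Fin.tail, Fin.val_zero]
  push_cast
  ring

theorem aCoef_succ (κ : Fin (d + 2) → ℝ) (ν : Fin (d + 1) → ℕ) (j : Fin d) :
    aCoef κ ν j.succ = aCoef (Fin.tail κ) (Fin.tail ν) j := by
  rw [aCoef, aCoef, tailSum_succ, ← Fin.succ_castSucc, sum_Ioi_succ]
  simp only [Fin.tail, Fin.val_succ]
  push_cast
  ring

/-- Once the first coordinate is fixed at `a`, the remaining factors form the same product in one
variable fewer, on the simplex of size `N - a`. -/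
theorem prodVal_cons (κ : Fin (d + 2) → ℝ) (N : ℝ) (ν : Fin (d + 1) → ℕ) (a : ℕ)
    (x : Fin (d + 1) → ℕ) :
    prodVal κ N ν (Fin.cons (α := fun _ => ℕ) a x) =
      hOne (ν 0) a (κ 0) (aCoef κ ν 0) (N - ((∑ i, Fin.tail ν i : ℕ) : ℝ)) *
        prodVal (Fin.tail κ) (N - a) (Fin.tail ν) x := by
  rw [prodVal, prodVal, Fin.prod_univ_succ]
  congr 1
  · rw [tailSum_zero]
    have : Finset.Iio (0 : Fin (d + 1)) = ∅ := by ext i; simp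
    simp [this]
  · refine Finset.prod_congr rfl fun j _ => ?_
    rw [tailSum_succ, aCoef_succ, sum_Iio_succ]
    simp only [← Fin.succ_castSucc, Fin.cons_succ, Fin.castSucc_zero, Fin.cons_zero, Fin.tail]
    congr 1
    ring

theorem kpoch_cons (κ : Fin (d + 2) → ℝ) (a : ℕ) (x : Fin (d + 1) → ℕ) :
    kpoch κ (Fin.cons (α := fun _ => ℕ) a x) / mfact (Fin.cons (α := fun _ => ℕ) a x) =
      poch (κ 0 + 1) a / (a.factorial : ℝ) * (kpoch (Fin.tail κ) x / mfact x) := by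
  have h1 : kpoch κ (Fin.cons (α := fun _ => ℕ) a x) = poch (κ 0 + 1) a * kpoch (Fin.tail κ) x := by
    rw [kpoch, Fin.prod_univ_succ]
    rfl
  have h2 : mfact (Fin.cons (α := fun _ => ℕ) a x) = (a.factorial : ℝ) * mfact x := by
    rw [mfact, Fin.prod_univ_succ]
    rfl
  rw [h1, h2, mul_div_mul_comm]

theorem lam_tail (κ : Fin (d + 2) → ℝ) : lam κ = κ 0 + 1 + lam (Fin.tail κ) := by
  rw [lam, lam, Fin.sum_univ_succ]
  simp only [Fin.tail]
  push_cast
  ring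

/-- A strengthening of orthogonality that survives induction on `d`: the moment is tracked as a
function of `N`. For fixed `x_1` the inner sum is a shifted weight, which serves as the second
factor of a one-variable Hahn weight, times a polynomial in `N - x_1`. The subtraction in the degree
bound truncates, so the moment is zero when `|s| < |ν|`. -/
theorem exists_sum_prodVal_monomial (d : ℕ) (κ : Fin (d + 1) → ℝ) (hκ : ∀ i, -1 < κ i)
    (ν s : Fin d → ℕ) :
    ∃ p ∈ Polynomial.degreeLT ℝ (∑ i, s i + 1 - ∑ i, ν i), ∀ N : ℕ,
      ∑ x ∈ multiIdx (d + 1) N, prodVal κ N ν x * (∏ i, (x i.castSucc : ℝ) ^ s i) *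
        (kpoch κ x / mfact x) =
      shiftWeight (lam κ + 2 * ((∑ i, ν i : ℕ) : ℝ)) (∑ i, ν i) N * p.eval (N : ℝ) := by
  induction d with
  | zero =>
    refine ⟨1, ?_, fun N => ?_⟩
    · rw [Polynomial.mem_degreeLT]
      simp
    · rw [multiIdx_one]
      simp [prodVal, kpoch, mfact, shiftWeight, lam]
  | succ d ih =>
    obtain ⟨p', hp', ih'⟩ := ih (Fin.tail κ) (fun i => hκ i.succ) (Fin.tail ν) (Fin.tail s)
    set n' := ∑ i, Fin.tail ν i with hn'
    set s' := ∑ i, Fin.tail s i with hs'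
    have hνs : ∑ i, ν i = ν 0 + n' := Fin.sum_univ_succ ν
    have hss : ∑ i, s i = s 0 + s' := Fin.sum_univ_succ s
    have hstep : ∀ N : ℕ, ∑ x ∈ multiIdx (d + 2) N, prodVal κ N ν x *
          (∏ i, (x i.castSucc : ℝ) ^ s i) * (kpoch κ x / mfact x) =
        ∑ q ∈ antidiagonal N, poch (κ 0 + 1) q.1 / (q.1.factorial : ℝ) *
          shiftWeight (aCoef κ ν 0 + 1) n' q.2 *
          (hOne (ν 0) q.1 (κ 0) (aCoef κ ν 0) ((N : ℝ) - n') *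
            ((q.1 : ℝ) ^ s 0 * p'.eval (q.2 : ℝ))) := by
      intro N
      rw [sum_multiIdx_succ]
      refine Finset.sum_congr rfl fun q hq => ?_
      have hN : (N : ℝ) - q.1 = q.2 := by
        rw [← mem_antidiagonal.1 hq]
        push_cast
        ring
      have h := ih' q.2
      have h2 : ∀ x : Fin (d + 1) → ℕ,
          prodVal κ N ν (Fin.cons (α := fun _ => ℕ) q.1 x) *
            (∏ i : Fin (d + 1),
              ((Fin.cons (α := fun _ => ℕ) q.1 x : Fin (d + 2) → ℕ) i.castSucc : ℝ) ^ s i) *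
            (kpoch κ (Fin.cons (α := fun _ => ℕ) q.1 x) /
              mfact (Fin.cons (α := fun _ => ℕ) q.1 x)) =
          poch (κ 0 + 1) q.1 / (q.1.factorial : ℝ) *
            (hOne (ν 0) q.1 (κ 0) (aCoef κ ν 0) ((N : ℝ) - n') * (q.1 : ℝ) ^ s 0) *
          (prodVal (Fin.tail κ) q.2 (Fin.tail ν) x *
            (∏ i : Fin d, (x i.castSucc : ℝ) ^ Fin.tail s i) *
            (kpoch (Fin.tail κ) x / mfact x)) := by
        intro x
        rw [prodVal_cons, kpoch_cons, Fin.prod_univ_succ, hN, ← hn']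
        simp only [← Fin.succ_castSucc, Fin.cons_succ, Fin.castSucc_zero, Fin.cons_zero, Fin.tail]
        ring
      rw [Finset.sum_congr rfl fun x _ => h2 x, ← Finset.mul_sum, h, aCoef_zero]
      ring
    have ha : -1 < aCoef κ ν 0 := by
      have h1 := aCoef_zero κ ν
      have h2 := lam_pos (κ := Fin.tail κ) fun i => hκ i.succ
      have h3 : (0 : ℝ) ≤ ((∑ i, Fin.tail ν i : ℕ) : ℝ) := Nat.cast_nonneg _
      linarith
    by_cases hle : n' ≤ s'
    · obtain ⟨E, hE⟩ := Nat.exists_eq_add_of_le hle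
      have hp'' : p' ∈ Polynomial.degreeLT ℝ (E + 1) := by
        have : s' + 1 - n' = E + 1 := by omega
        rwa [this] at hp'
      -- The weight vanishes for `N - x_1 < n'`, so `N - x_1 = n' + y`; this explains the shift by
      -- `n'` here and the composition with `X - n'` below.
      obtain ⟨p, hp, hgood⟩ := polynomial_mem_goodFun (ν 0) (hκ 0) ha (n' : ℝ) (s 0) E hp''
      refine ⟨p.comp (Polynomial.X - Polynomial.C (n' : ℝ)), ?_, fun N => ?_⟩
      · have hdeg : s 0 + E + 1 - ν 0 = ∑ i, s i + 1 - ∑ i, ν i := by omega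
        rw [← hdeg]
        by_cases h0 : p = 0
        · rw [h0, Polynomial.zero_comp]
          exact Submodule.zero_mem _
        · rw [Polynomial.mem_degreeLT] at hp ⊢
          refine lt_of_le_of_lt Polynomial.degree_le_natDegree ?_
          rwa [Polynomial.natDegree_comp, Polynomial.natDegree_X_sub_C, mul_one,
            ← Polynomial.degree_eq_natDegree h0]
      · rw [hstep]
        by_cases hN : n' ≤ N
        · rw [sum_antidiagonal_shift_snd hN]
          · have hM : ((N - n' : ℕ) : ℝ) = (N : ℝ) - n' := Nat.cast_sub hN
            have hsw : shiftWeight (lam κ + 2 * ((∑ i, ν i : ℕ) : ℝ)) (∑ i, ν i) N =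
                shiftWeight (κ 0 + aCoef κ ν 0 + 2 + 2 * ν 0) (ν 0) (N - n') := by
              have e1 : lam κ + 2 * ((∑ i, ν i : ℕ) : ℝ) =
                  κ 0 + aCoef κ ν 0 + 2 + 2 * ν 0 := by
                have := aCoef_zero κ ν
                rw [lam_tail, hνs]
                push_cast
                rw [← hn'] at this
                linarith
              have e2 : N - ∑ i, ν i = N - n' - ν 0 := by omega
              rw [shiftWeight, shiftWeight, e1, e2]
              have e3 : (∑ i, ν i ≤ N) ↔ ν 0 ≤ N - n' := by omega
              simp only [e3]
            rw [hsw, Polynomial.eval_comp, Polynomial.eval_sub, Polynomial.eval_X,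
              Polynomial.eval_C, ← hM, ← hgood]
            refine Finset.sum_congr rfl fun q _ => ?_
            rw [shiftWeight, if_pos (by omega), Nat.add_sub_cancel_left]
            push_cast
            rw [add_comm (n' : ℝ)]
          · intro q hq
            rw [shiftWeight, if_neg (by omega)]
            ring
        · rw [shiftWeight, if_neg (by omega), zero_mul]
          refine Finset.sum_eq_zero fun q hq => ?_
          have := mem_antidiagonal.1 hq
          rw [shiftWeight, if_neg (by omega)]
          ring
    · have h0 : p' = 0 := by
        have : s' + 1 - n' = 0 := by omega
        rw [this, Polynomial.mem_degreeLT] at hp'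
        by_contra hne
        rw [Polynomial.degree_eq_natDegree hne] at hp'
        exact absurd (Nat.cast_lt.1 hp') (Nat.not_lt_zero _)
      refine ⟨0, Submodule.zero_mem _, fun N => ?_⟩
      rw [hstep, h0]
      simp

theorem sum_prodVal_mul_eq_zero (κ : Fin (d + 1) → ℝ) (hκ : ∀ i, -1 < κ i) (ν : Fin d → ℕ)
    {q : MvPolynomial (Fin d) ℝ} (hq : q ∈ degLT (Fin d) (∑ i, ν i)) (N : ℕ) :
    ∑ x ∈ multiIdx (d + 1) N, prodVal κ N ν x * evalAt q x * (kpoch κ x / mfact x) = 0 := by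
  have h : ∀ x : Fin (d + 1) → ℕ, prodVal κ N ν x * evalAt q x * (kpoch κ x / mfact x) =
      ∑ s ∈ q.support, coeff s q * (prodVal κ N ν x * (∏ i, (x i.castSucc : ℝ) ^ s i) *
        (kpoch κ x / mfact x)) := by
    intro x
    rw [evalAt, eval_eq', Finset.mul_sum, Finset.sum_mul]
    exact Finset.sum_congr rfl fun s _ => by ring
  rw [Finset.sum_congr rfl fun x _ => h x, Finset.sum_comm]
  refine Finset.sum_eq_zero fun s hs => ?_
  rw [← Finset.mul_sum]
  obtain ⟨p, hp, hsum⟩ := exists_sum_prodVal_monomial d κ hκ ν s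
  have hlt : ∑ i, s i < ∑ i, ν i := by
    by_contra hle
    refine mem_support_iff.1 hs (hq s ?_)
    rw [Finsupp.degree_eq_sum]
    exact not_lt.1 hle
  have h0 : p = 0 := by
    have : ∑ i, s i + 1 - ∑ i, ν i = 0 := by omega
    rw [this, Polynomial.mem_degreeLT] at hp
    by_contra hne
    rw [Polynomial.degree_eq_natDegree hne] at hp
    exact absurd (Nat.cast_lt.1 hp) (Nat.not_lt_zero _)
  rw [hsum, h0]
  simp

/-- The constant part of `M` enters only through constants added to linear factors, so it does not
affect the top component. -/
theorem hahnOne_topEq (n : ℕ) (j : Fin d) (a b : ℝ) {L : MvPolynomial (Fin d) ℝ}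
    (hL : L ∈ degLT (Fin d) 2) (M M' : ℝ) :
    TopEq n (hahnOne n (X j) a b (C M - L)) (hahnOne n (X j) a b (C M' - L)) := by
  refine TopEq.sum fun k hk => TopEq.smul ?_ _
  have hkn : k ≤ n := Nat.lt_succ_iff.1 (Finset.mem_range.1 hk)
  have h1 : TopEq k (poch (-X j : MvPolynomial (Fin d) ℝ) k) (poch (-X j) k) := by
    have := TopEq.poch (Submodule.neg_mem _ (X_mem_degLT j)) 0 0 k
    simpa using this
  have h2 := TopEq.poch hL (-M + k) (-M' + k) (n - k)
  have e : ∀ c : ℝ, -(C c - L) + (k : MvPolynomial (Fin d) ℝ) = L + C (-c + k) := by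
    intro c
    rw [C_add, C_neg, map_natCast]
    ring
  have h3 := h1.mul h2
  rw [Nat.add_sub_cancel' hkn] at h3
  rw [e, e]
  exact h3

theorem hahnProd_topEq (κ : Fin (d + 1) → ℝ) (N N' : ℝ) (ν : Fin d → ℕ) :
    TopEq (∑ i, ν i) (hahnProd κ N ν) (hahnProd κ N' ν) := by
  refine TopEq.prod fun j _ => ?_
  have hL : (∑ i ∈ Finset.Iio j, (X i : MvPolynomial (Fin d) ℝ)) ∈ degLT (Fin d) 2 :=
    Submodule.sum_mem _ fun i _ => X_mem_degLT i
  have h := hahnOne_topEq (ν j) j (κ j.castSucc) (aCoef κ ν j) hL (N - tailSum ν j)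
    (N' - tailSum ν j)
  have e : ∀ c : ℝ, (C (c - tailSum ν j) : MvPolynomial (Fin d) ℝ) - ∑ i ∈ Finset.Iio j, X i =
      C c - (∑ i ∈ Finset.Iio j, X i) - C (tailSum ν j : ℝ) := by
    intro c
    rw [C_sub]
    ring
  rwa [e, e] at h

/-- For different total degrees, the larger one is orthogonal to all lower degrees. For equal total
degrees the tails must differ, and the inner sum vanishes by induction for each fixed first
coordinate. -/
theorem sum_prodVal_mul_prodVal_of_ne (d : ℕ) (κ : Fin (d + 1) → ℝ) (hκ : ∀ i, -1 < κ i)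
    (ν μ : Fin d → ℕ) (hne : ν ≠ μ) (N : ℕ) :
    ∑ x ∈ multiIdx (d + 1) N, prodVal κ N ν x * prodVal κ N μ x * (kpoch κ x / mfact x) = 0 := by
  induction d generalizing N with
  | zero => exact absurd (Subsingleton.elim ν μ) hne
  | succ d ih =>
    have hlt : ∀ ν μ : Fin (d + 1) → ℕ, ∑ i, μ i < ∑ i, ν i →
        ∑ x ∈ multiIdx (d + 2) N, prodVal κ N ν x * prodVal κ N μ x *
          (kpoch κ x / mfact x) = 0 := by
      intro ν μ h
      have := sum_prodVal_mul_eq_zero κ hκ ν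
        (degLT_mono (Nat.succ_le_of_lt h) (hahnProd_topEq κ N N μ).1) N
      simpa only [evalAt_hahnProd] using this
    rcases lt_trichotomy (∑ i, ν i) (∑ i, μ i) with h | h | h
    · rw [← hlt μ ν h]
      exact Finset.sum_congr rfl fun x _ => by ring
    · have htail : Fin.tail ν ≠ Fin.tail μ := by
        intro he
        refine hne ?_
        rw [Fin.sum_univ_succ, Fin.sum_univ_succ (f := μ)] at h
        have h' : ∀ i : Fin d, ν i.succ = μ i.succ := fun i => congrFun he i
        simp only [h', add_left_inj] at h
        funext i
        exact Fin.cases h h' i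
      rw [sum_multiIdx_succ]
      refine Finset.sum_eq_zero fun q hq => ?_
      have hN : (N : ℝ) - q.1 = q.2 := by
        rw [← mem_antidiagonal.1 hq]
        push_cast
        ring
      have h2 := ih (Fin.tail κ) (fun i => hκ i.succ) (Fin.tail ν) (Fin.tail μ) htail q.2
      have h3 := congrArg (fun t => hOne (ν 0) q.1 (κ 0) (aCoef κ ν 0)
        ((N : ℝ) - ((∑ i, Fin.tail ν i : ℕ) : ℝ)) * hOne (μ 0) q.1 (κ 0) (aCoef κ μ 0)
        ((N : ℝ) - ((∑ i, Fin.tail μ i : ℕ) : ℝ)) *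
        (poch (κ 0 + 1) q.1 / (q.1.factorial : ℝ)) * t) h2
      simp only [mul_zero, Finset.mul_sum] at h3
      rw [← h3]
      refine Finset.sum_congr rfl fun x _ => ?_
      rw [prodVal_cons, prodVal_cons, kpoch_cons, hN]
      ring
    · exact hlt ν μ h

theorem hOne_zero (n : ℕ) (a b M : ℝ) : hOne n 0 a b M = poch (-M) n := by
  rw [hOne, Finset.sum_range_succ']
  rw [Finset.sum_eq_zero]
  · simp
  · intro k _
    have h0 : poch (-(0 : ℝ)) (k + 1) = 0 := by rw [neg_zero, poch_succ_left, zero_mul]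
    rw [h0, zero_mul, mul_zero]

theorem tailSum_add_le (ν : Fin d → ℕ) (j : Fin d) : ν j + tailSum ν j ≤ ∑ i, ν i := by
  classical
  rw [tailSum, ← Finset.sum_insert (s := Finset.Ioi j) (by simp)]
  exact Finset.sum_le_sum_of_subset (Finset.subset_univ _)

/-- At the origin the `j`-th factor is `(-M_j)_{ν_j}` with `M_j = N - |ν^{j+1}| ≥ ν_j`, hence
nonzero. -/
theorem hahnProd_ne_zero (κ : Fin (d + 1) → ℝ) {N : ℕ} (ν : Fin d → ℕ) (h : ∑ i, ν i ≤ N) :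
    hahnProd κ N ν ≠ 0 := by
  intro h0
  have h1 := evalAt_hahnProd κ N ν 0
  rw [h0] at h1
  have h2 : evalAt (0 : MvPolynomial (Fin d) ℝ) 0 = 0 := by simp [evalAt]
  rw [h2, prodVal] at h1
  refine Finset.prod_ne_zero_iff.2 (fun j _ => ?_) h1.symm
  have hj := tailSum_add_le ν j
  simp only [Pi.zero_apply, Nat.cast_zero, Finset.sum_const_zero, sub_zero]
  rw [hOne_zero, ← Nat.cast_sub (by omega)]
  exact poch_neg_natCast_ne_zero (by omega)

end Peeling

/-! ### The spaces `𝒱_n^d`, the action of the operators on them, and the basis `H_ν`. -/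

section Orthogonality

variable {d : ℕ}

/-- The Hahn inner product as a bilinear form. -/
def hahnForm (κ : Fin (d + 1) → ℝ) (N : ℕ) :
    MvPolynomial (Fin d) ℝ →ₗ[ℝ] MvPolynomial (Fin d) ℝ →ₗ[ℝ] ℝ :=
  LinearMap.mk₂ ℝ (hahnInner κ N) (hahnInner_add_left κ N) (hahnInner_smul_left κ N)
    (fun f g h => by
      rw [hahnInner_comm, hahnInner_add_left, hahnInner_comm κ N g, hahnInner_comm κ N h])
    (fun c f g => by
      rw [hahnInner_comm, hahnInner_smul_left, hahnInner_comm κ N g]; rfl)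

theorem hahnForm_apply (κ : Fin (d + 1) → ℝ) (N : ℕ) (p q : MvPolynomial (Fin d) ℝ) :
    hahnForm κ N p q = hahnInner κ N p q := rfl

/-- The weighted pairing of functions on the lattice simplex. -/
def latticeSum (κ : Fin (d + 1) → ℝ) (N : ℕ) (f g : {x // x ∈ multiIdx (d + 1) N} → ℝ) : ℝ :=
  ∑ x, f x * g x * (kpoch κ x.1 / mfact x.1)

theorem hahnInner_eq (κ : Fin (d + 1) → ℝ) (N : ℕ) (p q : MvPolynomial (Fin d) ℝ) :
    hahnInner κ N p q = (N.factorial : ℝ) / poch (lam κ) N *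
      latticeSum κ N (latticeEval d N p) (latticeEval d N q) := by
  rw [hahnInner, latticeSum, ← Finset.sum_coe_sort]
  rfl

theorem latticeSum_lowerOp (κ : Fin (d + 1) → ℝ) {m N : ℕ} (hm : m ≤ N)
    (q h : MvPolynomial (Fin d) ℝ) :
    latticeSum κ m (lowerOp κ m N q) (latticeEval d m h) =
      latticeSum κ N (latticeEval d N q) (raiseOp d m N h) :=
  sum_lowerOp_mul κ hm q h

theorem latticeSum_comm (κ : Fin (d + 1) → ℝ) (N : ℕ)
    (f g : {x // x ∈ multiIdx (d + 1) N} → ℝ) : latticeSum κ N f g = latticeSum κ N g f :=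
  Finset.sum_congr rfl fun x _ => by ring

theorem mem_orthSpace {κ : Fin (d + 1) → ℝ} {N n : ℕ} {p : MvPolynomial (Fin d) ℝ} :
    p ∈ orthSpace κ N n ↔ p ∈ degLT (Fin d) (n + 1) ∧
      ∀ q ∈ degLT (Fin d) n, hahnInner κ N p q = 0 := by
  rw [mem_degLT_succ]
  refine and_congr_right fun _ => ⟨fun h q hq => ?_, fun h q hq =>
    h q (mem_degLT_of_totalDegree_lt hq)⟩
  rcases eq_zero_or_totalDegree_lt hq with rfl | hq
  · exact map_zero (hahnForm κ N p)
  · exact h q hq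

theorem mem_orthSpace_iff_latticeSum {κ : Fin (d + 1) → ℝ} (hκ : ∀ i, -1 < κ i) {N n : ℕ}
    {p : MvPolynomial (Fin d) ℝ} :
    p ∈ orthSpace κ N n ↔ p ∈ degLT (Fin d) (n + 1) ∧
      ∀ q ∈ degLT (Fin d) n, latticeSum κ N (latticeEval d N p) (latticeEval d N q) = 0 := by
  rw [mem_orthSpace]
  have hc : (N.factorial : ℝ) / poch (lam κ) N ≠ 0 :=
    (div_pos (by positivity) (poch_pos (lam_pos hκ) N)).ne'
  simp only [hahnInner_eq, mul_eq_zero, hc, false_or]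

/-- The difference has degree below `n` and is orthogonal to all such polynomials, hence to itself.
-/
theorem eq_of_mem_orthSpace {κ : Fin (d + 1) → ℝ} (hκ : ∀ i, -1 < κ i) {N n : ℕ} (hn : n ≤ N)
    {p q : MvPolynomial (Fin d) ℝ} (hp : p ∈ orthSpace κ N n) (hq : q ∈ orthSpace κ N n)
    (h : p - q ∈ degLT (Fin d) n) : p = q := by
  have hm := mem_orthSpace.1 (Submodule.sub_mem _ hp hq)
  exact sub_eq_zero.1 (eq_zero_of_hahnInner_self hκ ((mem_degLT_succ.1 hm.1).trans hn)
    (hm.2 _ h))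

theorem exists_raiseOp_of_lt {m : ℕ} (N : ℕ) {n : ℕ} (hn : n ≤ m) {q : MvPolynomial (Fin d) ℝ}
    (hq : q ∈ degLT (Fin d) n) :
    ∃ r ∈ degLT (Fin d) n, raiseOp d m N q = latticeEval d N r := by
  rcases n with _ | k
  · exact ⟨0, Submodule.zero_mem _, by rw [mem_degLT_zero.1 hq, map_zero, map_zero]⟩
  · obtain ⟨r, hr, h⟩ := exists_raiseOp N (by omega : k ≤ m) hq
    exact ⟨_, Submodule.add_mem _ (Submodule.smul_mem _ _ hq) (degLT_mono (Nat.le_succ k) hr), h⟩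

theorem exists_lowerOp_of_lt (κ : Fin (d + 1) → ℝ) (m N : ℕ) {n : ℕ}
    {q : MvPolynomial (Fin d) ℝ} (hq : q ∈ degLT (Fin d) n) :
    ∃ r ∈ degLT (Fin d) n, lowerOp κ m N q = latticeEval d m r := by
  rcases n with _ | k
  · exact ⟨0, Submodule.zero_mem _, by rw [mem_degLT_zero.1 hq, map_zero, map_zero]⟩
  · obtain ⟨r, hr, h⟩ := exists_lowerOp κ m N hq
    exact ⟨_, Submodule.add_mem _ (Submodule.smul_mem _ _ hq) (degLT_mono (Nat.le_succ k) hr), h⟩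

/-- Pairing with a lower-degree `q` moves `raiseOp` onto `q`, and `raiseOp` preserves lower degrees.
-/
theorem mem_orthSpace_of_lowerOp {κ : Fin (d + 1) → ℝ} (hκ : ∀ i, -1 < κ i) {n m N : ℕ}
    (hnm : n ≤ m) (hmN : m ≤ N) {f g : MvPolynomial (Fin d) ℝ} (hf : f ∈ orthSpace κ N n)
    (hg : g ∈ degLT (Fin d) (n + 1)) (h : lowerOp κ m N f = latticeEval d m g) :
    g ∈ orthSpace κ m n := by
  refine (mem_orthSpace_iff_latticeSum hκ).2 ⟨hg, fun q hq => ?_⟩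
  obtain ⟨r, hr, hqr⟩ := exists_raiseOp_of_lt N hnm hq
  rw [← h, latticeSum_lowerOp κ hmN, hqr]
  exact ((mem_orthSpace_iff_latticeSum hκ).1 hf).2 r hr

theorem mem_orthSpace_of_raiseOp {κ : Fin (d + 1) → ℝ} (hκ : ∀ i, -1 < κ i) {n m N : ℕ}
    (hmN : m ≤ N) {f g : MvPolynomial (Fin d) ℝ} (hf : f ∈ orthSpace κ m n)
    (hg : g ∈ degLT (Fin d) (n + 1)) (h : raiseOp d m N f = latticeEval d N g) :
    g ∈ orthSpace κ N n := by
  refine (mem_orthSpace_iff_latticeSum hκ).2 ⟨hg, fun q hq => ?_⟩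
  obtain ⟨r, hr, hqr⟩ := exists_lowerOp_of_lt κ m N hq
  rw [← h, latticeSum_comm, ← latticeSum_lowerOp κ hmN, hqr, latticeSum_comm]
  exact ((mem_orthSpace_iff_latticeSum hκ).1 hf).2 r hr

theorem aCoef_add_one_pos {κ : Fin (d + 1) → ℝ} (hκ : ∀ i, -1 < κ i) (ν : Fin d → ℕ)
    (j : Fin d) : 0 < aCoef κ ν j + 1 := by
  have h : 0 < ∑ i ∈ Finset.Ioi j.castSucc, (κ i + 1) :=
    Finset.sum_pos (fun i _ => by linarith [hκ i])
      ⟨Fin.last d, Finset.mem_Ioi.2 (Fin.castSucc_lt_last j)⟩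
  rw [Finset.sum_add_distrib, Finset.sum_const, Fin.card_Ioi, nsmul_eq_mul, mul_one,
    Fin.val_castSucc, Nat.cast_sub (by have := j.2; omega)] at h
  push_cast at h
  have h3 : (0 : ℝ) ≤ (tailSum ν j : ℝ) := Nat.cast_nonneg _
  rw [aCoef]
  linarith

/-- The part of the constant factor of `hahnH` that does not depend on `N`. -/
def hahnConst (κ : Fin (d + 1) → ℝ) (ν : Fin d → ℕ) : ℝ :=
  ∏ j : Fin d, poch (κ j.castSucc + 1) (ν j) / poch (aCoef κ ν j + 1) (ν j)

theorem hahnH_eq (κ : Fin (d + 1) → ℝ) (N : ℕ) (ν : Fin d → ℕ) :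
    hahnH κ N ν = ((-1) ^ (∑ j, ν j) / poch (-(N : ℝ)) (∑ j, ν j) * hahnConst κ ν) •
      hahnProd κ N ν := by
  rw [hahnH, Finset.prod_smul, mul_smul]
  rfl

theorem hahnConst_ne_zero {κ : Fin (d + 1) → ℝ} (hκ : ∀ i, -1 < κ i) (ν : Fin d → ℕ) :
    hahnConst κ ν ≠ 0 :=
  Finset.prod_ne_zero_iff.2 fun j _ => div_ne_zero
    (poch_pos (by linarith [hκ j.castSucc]) _).ne' (poch_pos (aCoef_add_one_pos hκ ν j) _).ne'

theorem hahnH_ne_zero {κ : Fin (d + 1) → ℝ} (hκ : ∀ i, -1 < κ i) {N : ℕ} {ν : Fin d → ℕ}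
    (h : ∑ i, ν i ≤ N) : hahnH κ N ν ≠ 0 := by
  rw [hahnH_eq]
  exact smul_ne_zero (mul_ne_zero (div_ne_zero (pow_ne_zero _ (by norm_num))
    (poch_neg_natCast_ne_zero h)) (hahnConst_ne_zero hκ ν)) (hahnProd_ne_zero κ ν h)

theorem hahnProd_mem_orthSpace {κ : Fin (d + 1) → ℝ} (hκ : ∀ i, -1 < κ i) (N : ℕ)
    (ν : Fin d → ℕ) : hahnProd κ N ν ∈ orthSpace κ N (∑ i, ν i) := by
  refine mem_orthSpace.2 ⟨(hahnProd_topEq κ N N ν).1, fun q hq => ?_⟩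
  rw [hahnInner]
  simp only [evalAt_hahnProd]
  rw [sum_prodVal_mul_eq_zero κ hκ ν hq, mul_zero]

theorem hahnH_mem_orthSpace {κ : Fin (d + 1) → ℝ} (hκ : ∀ i, -1 < κ i) (N : ℕ)
    (ν : Fin d → ℕ) : hahnH κ N ν ∈ orthSpace κ N (∑ i, ν i) := by
  rw [hahnH_eq]
  exact Submodule.smul_mem _ _ (hahnProd_mem_orthSpace hκ N ν)

theorem hahnInner_hahnH_of_ne {κ : Fin (d + 1) → ℝ} (hκ : ∀ i, -1 < κ i) (N : ℕ)
    {ν μ : Fin d → ℕ} (hne : ν ≠ μ) : hahnInner κ N (hahnH κ N ν) (hahnH κ N μ) = 0 := by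
  have h : hahnInner κ N (hahnProd κ N ν) (hahnProd κ N μ) = 0 := by
    rw [hahnInner]
    simp only [evalAt_hahnProd]
    rw [sum_prodVal_mul_prodVal_of_ne d κ hκ ν μ hne, mul_zero]
  rw [hahnH_eq, hahnH_eq, hahnInner_smul_left, hahnInner_comm, hahnInner_smul_left,
    hahnInner_comm, h, mul_zero, mul_zero]

theorem hahnB_ne_zero {κ : Fin (d + 1) → ℝ} (hκ : ∀ i, -1 < κ i) {N : ℕ} {ν : Fin d → ℕ}
    (h : ∑ i, ν i ≤ N) : hahnB κ N ν ≠ 0 := fun h0 =>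
  hahnH_ne_zero hκ h (eq_zero_of_hahnInner_self hκ
    ((hahnH_mem_orthSpace hκ N ν).1.trans h) h0)

theorem hahnH_sub_smul_mem (κ : Fin (d + 1) → ℝ) {m N : ℕ} {ν : Fin d → ℕ}
    (hm : ∑ i, ν i ≤ m) (hN : ∑ i, ν i ≤ N) :
    hahnH κ N ν - (poch (-(m : ℝ)) (∑ i, ν i) / poch (-(N : ℝ)) (∑ i, ν i)) • hahnH κ m ν ∈
      degLT (Fin d) (∑ i, ν i) := by
  have h1 := poch_neg_natCast_ne_zero hm
  have h2 := poch_neg_natCast_ne_zero hN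
  have h3 : poch (-(m : ℝ)) (∑ i, ν i) / poch (-(N : ℝ)) (∑ i, ν i) *
      ((-1) ^ (∑ j, ν j) / poch (-(m : ℝ)) (∑ j, ν j) * hahnConst κ ν) =
      (-1) ^ (∑ j, ν j) / poch (-(N : ℝ)) (∑ j, ν j) * hahnConst κ ν := by
    field_simp
  rw [hahnH_eq, hahnH_eq, smul_smul, h3, ← smul_sub]
  exact Submodule.smul_mem _ _ (hahnProd_topEq κ N m ν).2.2

/-- Both sides come from elements of `𝒱_n^d` for size `m` with the same top component. The first
factor is the eigenvalue of `lowerOp` in degree `|ν|`, the second the ratio of the top components of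
the two `H_ν`. -/
theorem lowerOp_hahnH {κ : Fin (d + 1) → ℝ} (hκ : ∀ i, -1 < κ i) {m N : ℕ} {ν : Fin d → ℕ}
    (hm : ∑ i, ν i ≤ m) (hmN : m ≤ N) :
    lowerOp κ m N (hahnH κ N ν) = latticeEval d m
      ((poch (lam κ + m + (∑ i, ν i : ℕ)) (N - m) / ((N - m).factorial : ℝ) *
        (poch (-(m : ℝ)) (∑ i, ν i) / poch (-(N : ℝ)) (∑ i, ν i))) • hahnH κ m ν) := by
  have hV := hahnH_mem_orthSpace hκ N ν
  have hmem := (mem_orthSpace.1 hV).1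
  obtain ⟨r, hr, h⟩ := exists_lowerOp κ m N hmem
  have hg := mem_orthSpace_of_lowerOp hκ hm hmN hV (Submodule.add_mem _
    (Submodule.smul_mem _ _ hmem) (degLT_mono (Nat.le_succ _) hr)) h
  rw [h]
  congr 1
  refine eq_of_mem_orthSpace hκ hm hg
    (Submodule.smul_mem _ _ (hahnH_mem_orthSpace hκ m ν)) ?_
  rw [mul_smul, add_sub_right_comm, ← smul_sub]
  exact Submodule.add_mem _ (Submodule.smul_mem _ _ (hahnH_sub_smul_mem κ hm (hm.trans hmN))) hr

theorem raiseOp_hahnH {κ : Fin (d + 1) → ℝ} (hκ : ∀ i, -1 < κ i) {m N : ℕ} {ν : Fin d → ℕ}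
    (hm : ∑ i, ν i ≤ m) (hmN : m ≤ N) :
    raiseOp d m N (hahnH κ m ν) = latticeEval d N
      (((-1) ^ (m - ∑ i, ν i) * poch (-(N : ℝ) + (∑ i, ν i : ℕ)) (m - ∑ i, ν i) /
          ((m - ∑ i, ν i).factorial : ℝ) *
        (poch (-(N : ℝ)) (∑ i, ν i) / poch (-(m : ℝ)) (∑ i, ν i))) • hahnH κ N ν) := by
  have hV := hahnH_mem_orthSpace hκ m ν
  have hmem := (mem_orthSpace.1 hV).1
  obtain ⟨r, hr, h⟩ := exists_raiseOp N hm hmem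
  have hg := mem_orthSpace_of_raiseOp hκ hmN hV (Submodule.add_mem _
    (Submodule.smul_mem _ _ hmem) (degLT_mono (Nat.le_succ _) hr)) h
  rw [h]
  congr 1
  refine eq_of_mem_orthSpace hκ (hm.trans hmN) hg
    (Submodule.smul_mem _ _ (hahnH_mem_orthSpace hκ N ν)) ?_
  rw [mul_smul, add_sub_right_comm, ← smul_sub]
  exact Submodule.add_mem _ (Submodule.smul_mem _ _ (hahnH_sub_smul_mem κ (hm.trans hmN) hm)) hr

/-- The coefficients of top degree of an element of `orthSpace`. -/
def topCoeff (κ : Fin (d + 1) → ℝ) (N n : ℕ) :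
    orthSpace κ N n →ₗ[ℝ] ({ν // ν ∈ multiIdx d n} → ℝ) :=
  LinearMap.pi fun ν => (lcoeff ℝ (Finsupp.equivFunOnFinite.symm ν.1)).comp
    (orthSpace κ N n).subtype

theorem topCoeff_injective {κ : Fin (d + 1) → ℝ} (hκ : ∀ i, -1 < κ i) {N n : ℕ} (hn : n ≤ N) :
    Function.Injective (topCoeff κ N n) := by
  rw [injective_iff_map_eq_zero]
  rintro ⟨p, hp⟩ h
  refine Subtype.ext (eq_of_mem_orthSpace hκ hn hp (Submodule.zero_mem _) fun s hs => ?_)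
  change coeff s (p - 0) = 0
  rw [sub_zero]
  rcases hs.eq_or_lt with hs | hs
  · have hmem : (s : Fin d → ℕ) ∈ multiIdx d n := by
      rw [mem_multiIdx, hs, Finsupp.degree_eq_sum]
    have h2 := congrFun h ⟨s, hmem⟩
    have e : Finsupp.equivFunOnFinite.symm (s : Fin d → ℕ) = s := by ext; rfl
    simpa [topCoeff, e] using h2
  · exact (mem_orthSpace.1 hp).1 s hs

/-- Injectivity of `topCoeff` bounds the dimension by the number of `ν` with `|ν| = n`, and that
many orthogonal nonzero `H_ν` are independent. -/
theorem exists_eq_sum_hahnH {κ : Fin (d + 1) → ℝ} (hκ : ∀ i, -1 < κ i) {N n : ℕ} (hn : n ≤ N)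
    {p : MvPolynomial (Fin d) ℝ} (hp : p ∈ orthSpace κ N n) :
    ∃ c : {ν // ν ∈ multiIdx d n} → ℝ, ∑ ν, c ν • hahnH κ N ν.1 = p := by
  let b : {ν // ν ∈ multiIdx d n} → orthSpace κ N n := fun ν =>
    ⟨hahnH κ N ν.1, by
      have := hahnH_mem_orthSpace hκ N ν.1
      rwa [mem_multiIdx.1 ν.2] at this⟩
  have hfin : FiniteDimensional ℝ (orthSpace κ N n) :=
    FiniteDimensional.of_injective _ (topCoeff_injective hκ hn)
  have hle : Module.finrank ℝ (orthSpace κ N n) ≤ Fintype.card {ν // ν ∈ multiIdx d n} := by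
    rw [← Module.finrank_fintype_fun_eq_card ℝ]
    exact LinearMap.finrank_le_finrank_of_injective (topCoeff_injective hκ hn)
  have hli : LinearIndependent ℝ b := by
    rw [Fintype.linearIndependent_iff]
    intro c hc μ
    have h1 : ∑ ν, c ν • hahnH κ N ν.1 = 0 := by
      have := congrArg Subtype.val hc
      simpa [b] using this
    have h2 := congrArg (fun p => hahnForm κ N p (hahnH κ N μ.1)) h1
    simp only [map_sum, map_smul, LinearMap.sum_apply, LinearMap.smul_apply, map_zero,
      LinearMap.zero_apply, hahnForm_apply, smul_eq_mul] at h2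
    rw [Finset.sum_eq_single μ] at h2
    · exact (mul_eq_zero.1 h2).resolve_right
        (hahnB_ne_zero hκ ((mem_multiIdx.1 μ.2).trans_le hn))
    · intro ν _ hne
      rw [hahnInner_hahnH_of_ne hκ N fun h => hne (Subtype.ext h), mul_zero]
    · intro h
      exact absurd (Finset.mem_univ μ) h
  have hspan := hli.span_eq_top_of_card_eq_finrank'
    (le_antisymm hli.fintype_card_le_finrank hle)
  have hmem : (⟨p, hp⟩ : orthSpace κ N n) ∈ Submodule.span ℝ (Set.range b) := by
    rw [hspan]
    exact Submodule.mem_top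
  obtain ⟨c, hc⟩ := (Submodule.mem_span_range_iff_exists_fun ℝ).1 hmem
  refine ⟨c, ?_⟩
  have := congrArg Subtype.val hc
  simpa [b] using this

theorem eq_sum_hahnInner_smul {κ : Fin (d + 1) → ℝ} (hκ : ∀ i, -1 < κ i) {N n : ℕ} (hn : n ≤ N)
    {p : MvPolynomial (Fin d) ℝ} (hp : p ∈ orthSpace κ N n) :
    p = ∑ ν ∈ multiIdx d n, (hahnInner κ N p (hahnH κ N ν) / hahnB κ N ν) • hahnH κ N ν := by
  obtain ⟨c, hc⟩ := exists_eq_sum_hahnH hκ hn hp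
  rw [← Finset.sum_coe_sort]
  conv_lhs => rw [← hc]
  refine Finset.sum_congr rfl fun μ _ => ?_
  congr 1
  rw [eq_div_iff (hahnB_ne_zero hκ ((mem_multiIdx.1 μ.2).trans_le hn)), ← hahnForm_apply, ← hc]
  simp only [map_sum, map_smul, LinearMap.sum_apply, LinearMap.smul_apply, hahnForm_apply,
    smul_eq_mul]
  rw [Finset.sum_eq_single μ]
  · rfl
  · intro ν _ hne
    rw [hahnInner_hahnH_of_ne hκ N fun h => hne (Subtype.ext h), mul_zero]
  · intro h
    exact absurd (Finset.mem_univ μ) h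

end Orthogonality

/-! ### Projections of the `m_α` and the two expansions. -/

section Projection

variable {d : ℕ}

theorem evalAt_restrictPlane_monicMon (α : Fin (d + 1) → ℕ) {N : ℕ} {x : Fin (d + 1) → ℕ}
    (hx : x ∈ multiIdx (d + 1) N) :
    evalAt (restrictPlane N (monicMon α)) x = fallVal α x := by
  have hlast : (N : ℝ) - ∑ i : Fin d, (x i.castSucc : ℝ) = x (Fin.last d) := by
    rw [← mem_multiIdx.1 hx, Fin.sum_univ_castSucc]
    push_cast
    ring
  rw [restrictPlane, monicMon, evalAt, fallVal, Fin.prod_univ_castSucc, Fin.prod_univ_castSucc,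
    Finset.prod_mul_distrib, Finset.prod_pow_eq_pow_sum, Fin.sum_univ_castSucc]
  have hp : ∀ (q : MvPolynomial (Fin (d + 1)) ℝ) (k : ℕ) (f : MvPolynomial (Fin (d + 1)) ℝ →ₐ[ℝ]
      MvPolynomial (Fin d) ℝ), f (poch q k) = poch (f q) k := fun q k f => map_poch f.toRingHom q k
  simp only [map_mul, map_pow, map_neg, map_one, map_prod, hp, map_poch, aeval_X,
    Fin.snoc_castSucc, Fin.snoc_last, eval_X, map_sub, eval_C, map_sum, hlast]
  rw [pow_add]
  ring

theorem hahnInner_hahnProj {κ : Fin (d + 1) → ℝ} (hκ : ∀ i, -1 < κ i) {N n : ℕ} (hn : n ≤ N)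
    (p : MvPolynomial (Fin d) ℝ) {v : MvPolynomial (Fin d) ℝ} (hv : v ∈ orthSpace κ N n) :
    hahnInner κ N (hahnProj κ N n p) v = hahnInner κ N p v := by
  have h := (hahnProj_spec hκ hn p).2 v hv
  rw [← hahnForm_apply, map_sub, LinearMap.sub_apply, sub_eq_zero] at h
  exact h.symm

theorem hahnInner_monicMon (κ : Fin (d + 1) → ℝ) (N : ℕ) (α : Fin (d + 1) → ℕ)
    (v : MvPolynomial (Fin d) ℝ) :
    hahnInner κ N (restrictPlane N (monicMon α)) v = (N.factorial : ℝ) / poch (lam κ) N *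
      ∑ x ∈ multiIdx (d + 1) N, evalAt v x * fallVal α x * (kpoch κ x / mfact x) := by
  rw [hahnInner]
  congr 1
  refine Finset.sum_congr rfl fun x hx => ?_
  rw [evalAt_restrictPlane_monicMon α hx]
  ring

theorem hahnQ_mem_orthSpace {κ : Fin (d + 1) → ℝ} (hκ : ∀ i, -1 < κ i) {N n : ℕ} (hn : n ≤ N)
    (α : Fin (d + 1) → ℕ) : hahnQ κ N α n ∈ orthSpace κ N n :=
  Submodule.smul_mem _ _ (hahnProj_spec hκ hn _).1

theorem hahnQ_eq_sum {κ : Fin (d + 1) → ℝ} (hκ : ∀ i, -1 < κ i) {n m N : ℕ} (hnm : n ≤ m)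
    (hmN : m ≤ N) {α : Fin (d + 1) → ℕ} (hα : α ∈ multiIdx (d + 1) m) :
    hahnQ κ N α n =
      ((-1) ^ m * poch (-(m : ℝ)) n * poch (-(N : ℝ)) m * poch (lam κ) (N + n) /
        (poch (-(N : ℝ)) n * poch (lam κ) N * poch (lam κ) (m + n))) •
      ∑ ν ∈ multiIdx d n, (evalAt (hahnH κ m ν) α / hahnB κ N ν) • hahnH κ N ν := by
  have hn := hnm.trans hmN
  rw [eq_sum_hahnInner_smul hκ hn (hahnQ_mem_orthSpace hκ hn α), Finset.smul_sum]
  refine Finset.sum_congr rfl fun ν hν => ?_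
  rw [smul_smul]
  congr 1
  have hs := mem_multiIdx.1 hν
  have hV : hahnH κ N ν ∈ orthSpace κ N n := hs ▸ hahnH_mem_orthSpace hκ N ν
  have hk : kpoch κ α ≠ 0 := (kpoch_pos hκ α).ne'
  have hlow := congrFun (lowerOp_hahnH hκ (hs.trans_le hnm) hmN) ⟨α, hα⟩
  rw [map_smul, Pi.smul_apply, latticeEval_apply, smul_eq_mul, hs] at hlow
  have h1 := sum_mul_fallVal_eq_lowerOp κ hmN (hahnH κ N ν) ⟨α, hα⟩
  rw [hahnQ, hahnInner_smul_left, hahnInner_hahnProj hκ hn _ hV, hahnInner_monicMon, h1, hlow]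
  have hl : ∀ k, poch (lam κ) k ≠ 0 := fun k => (poch_pos (lam_pos hκ) k).ne'
  have hNn := poch_neg_natCast_ne_zero hn
  have hfac := neg_one_pow_mul_poch_neg hmN
  -- This split of `(λ_κ)_{N+n}` exhibits the eigenvalue of `lowerOp`; `hfac` supplies the matching
  -- `N! / (N - m)!`.
  have hN' : poch (lam κ) (N + n) =
      poch (lam κ) (m + n) * poch (lam κ + m + n) (N - m) := by
    have e : N + n = (m + n) + (N - m) := by omega
    rw [e, poch_add]
    push_cast
    rw [← add_assoc]
  have e2 : (-1) ^ m * poch (-(m : ℝ)) n * poch (-(N : ℝ)) m * poch (lam κ) (N + n) =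
      ((-1) ^ m * poch (-(N : ℝ)) m) * poch (-(m : ℝ)) n * poch (lam κ) (N + n) := by ring
  rw [e2, hfac, hN']
  have hl1 := hl N
  have hl2 := hl (m + n)
  field_simp

theorem hahnH_eq_sum {κ : Fin (d + 1) → ℝ} (hκ : ∀ i, -1 < κ i) {n m N : ℕ} (hnm : n ≤ m)
    (hmN : m ≤ N) {ν : Fin d → ℕ} (hν : ν ∈ multiIdx d n) :
    hahnH κ N ν = ((-1) ^ m * (m.factorial : ℝ) / poch (-(N : ℝ)) m) •
      ∑ α ∈ multiIdx (d + 1) m,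
        (kpoch κ α / mfact α * evalAt (hahnH κ m ν) α) • hahnQ κ N α n := by
  have hn := hnm.trans hmN
  have hs := mem_multiIdx.1 hν
  have hV : hahnH κ N ν ∈ orthSpace κ N n := hs ▸ hahnH_mem_orthSpace hκ N ν
  have hraise := raiseOp_hahnH hκ (hs.trans_le hnm) hmN
  rw [hs] at hraise
  set c : ℝ := (-1) ^ (m - n) * poch (-(N : ℝ) + n) (m - n) / ((m - n).factorial : ℝ) *
    (poch (-(N : ℝ)) n / poch (-(m : ℝ)) n) with hc
  set F := ∑ α ∈ multiIdx (d + 1) m,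
    (kpoch κ α / mfact α * evalAt (hahnH κ m ν) α) • hahnQ κ N α n with hF
  have hFV : F ∈ orthSpace κ N n :=
    Submodule.sum_mem _ fun α _ => Submodule.smul_mem _ _ (hahnQ_mem_orthSpace hκ hn α)
  -- Against `v` in `𝒱_n^d` the projections may be dropped, so `F` pairs like `raiseOp` applied to
  -- `H_ν(·; κ, m)`, that is, like `c • hahnH κ N ν`.
  have hinner : ∀ v ∈ orthSpace κ N n,
      hahnInner κ N F v = hahnInner κ N (c • hahnH κ N ν) v := by
    intro v hv
    have h1 : ∀ α ∈ multiIdx (d + 1) m,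
        hahnInner κ N ((kpoch κ α / mfact α * evalAt (hahnH κ m ν) α) • hahnQ κ N α n) v =
        (N.factorial : ℝ) / poch (lam κ) N * ∑ x ∈ multiIdx (d + 1) N,
          fallVal α x / mfact α * evalAt (hahnH κ m ν) α *
            (evalAt v x * (kpoch κ x / mfact x)) := by
      intro α _
      have hk : kpoch κ α ≠ 0 := (kpoch_pos hκ α).ne'
      rw [hahnInner_smul_left, hahnQ, hahnInner_smul_left, hahnInner_hahnProj hκ hn _ hv,
        hahnInner_monicMon]
      simp only [Finset.mul_sum]
      refine Finset.sum_congr rfl fun x _ => ?_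
      field_simp
    rw [← hahnForm_apply, hF, map_sum, LinearMap.sum_apply]
    simp only [hahnForm_apply]
    rw [Finset.sum_congr rfl h1, ← Finset.mul_sum, Finset.sum_comm, hahnInner]
    congr 1
    refine Finset.sum_congr rfl fun x hx => ?_
    have h2 := congrFun hraise ⟨x, hx⟩
    rw [raiseOp_apply, latticeEval_apply] at h2
    rw [← Finset.sum_mul, h2]
    ring
  have hFc : F = c • hahnH κ N ν := by
    have hcV : c • hahnH κ N ν ∈ orthSpace κ N n := Submodule.smul_mem _ _ hV
    have hd := Submodule.sub_mem _ hFV hcV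
    refine sub_eq_zero.1 (eq_zero_of_hahnInner_self hκ (hd.1.trans hn) ?_)
    have := hinner _ hd
    rw [← hahnForm_apply] at this ⊢
    rw [LinearMap.map_sub₂, this, hahnForm_apply, sub_self]
  -- The quotient reduces to signs via `(-N)_m = (-N)_n (-N + n)_{m-n}` and `m! = (-1)^n (-m)_n (m -
  -- n)!`.
  have hscal : (-1) ^ m * (m.factorial : ℝ) / poch (-(N : ℝ)) m * c = 1 := by
    have h1 : poch (-(N : ℝ)) m = poch (-(N : ℝ)) n * poch (-(N : ℝ) + n) (m - n) := by
      rw [← poch_add, Nat.add_sub_cancel' hnm]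
    have h2 := neg_one_pow_mul_poch_neg hnm
    have h3 := poch_neg_natCast_ne_zero hmN
    have h4 := poch_neg_natCast_ne_zero hnm
    rw [h1] at h3
    have h5 := left_ne_zero_of_mul h3
    have h6 := right_ne_zero_of_mul h3
    have h7 : (-1 : ℝ) ^ m = (-1) ^ n * (-1) ^ (m - n) := by
      rw [← pow_add, Nat.add_sub_cancel' hnm]
    have h8 : (-1 : ℝ) ^ (m - n) * (-1) ^ (m - n) = 1 := by rw [← mul_pow]; simp
    have h9 : (-1 : ℝ) ^ n * (-1) ^ n = 1 := by rw [← mul_pow]; simp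
    have h10 : (m.factorial : ℝ) = (-1) ^ n * poch (-(m : ℝ)) n * ((m - n).factorial : ℝ) := by
      rw [h2]
      field_simp
    rw [hc, h1, h10, h7]
    have hf : ((m - n).factorial : ℝ) ≠ 0 := by positivity
    calc _ = ((-1 : ℝ) ^ n * (-1) ^ n) * ((-1 : ℝ) ^ (m - n) * (-1) ^ (m - n)) := by field_simp
      _ = 1 := by rw [h8, h9, one_mul]
  rw [hFc, smul_smul, hscal, one_smul]

theorem span_hahnQ {κ : Fin (d + 1) → ℝ} (hκ : ∀ i, -1 < κ i) {n m N : ℕ} (hnm : n ≤ m)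
    (hmN : m ≤ N) :
    Submodule.span ℝ {p | ∃ α ∈ multiIdx (d + 1) m, p = hahnQ κ N α n} = orthSpace κ N n := by
  refine le_antisymm (Submodule.span_le.2 ?_) fun p hp => ?_
  · rintro _ ⟨α, _, rfl⟩
    exact hahnQ_mem_orthSpace hκ (hnm.trans hmN) α
  · rw [eq_sum_hahnInner_smul hκ (hnm.trans hmN) hp]
    refine Submodule.sum_mem _ fun ν hν => Submodule.smul_mem _ _ ?_
    rw [hahnH_eq_sum hκ hnm hmN hν]
    exact Submodule.smul_mem _ _ (Submodule.sum_mem _ fun α hα =>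
      Submodule.smul_mem _ _ (Submodule.subset_span ⟨α, hα, rfl⟩))

end Projection

end

end MultiHahn

theorem proposition3p6 {d : ℕ} (κ : Fin (d + 1) → ℝ) (hκ : ∀ i, -1 < κ i)
    (n m N : ℕ) (hnm : n ≤ m) (hmN : m ≤ N) :
    (∀ α ∈ multiIdx (d + 1) m,
      hahnQ κ N α n =
        ((-1) ^ m * poch (-(m : ℝ)) n * poch (-(N : ℝ)) m *
            poch (lam κ) (N + n) /
          (poch (-(N : ℝ)) n * poch (lam κ) N *
            poch (lam κ) (m + n))) •
        ∑ ν ∈ multiIdx d n,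
          (evalAt (hahnH κ m ν) α / hahnB κ N ν) •
            hahnH κ N ν) ∧
    (∀ ν ∈ multiIdx d n,
      hahnH κ N ν =
        ((-1) ^ m * (m.factorial : ℝ) / poch (-(N : ℝ)) m) •
        ∑ α ∈ multiIdx (d + 1) m,
          (kpoch κ α / mfact α *
              evalAt (hahnH κ m ν) α) •
            hahnQ κ N α n) ∧
    Submodule.span ℝ {p | ∃ α ∈ multiIdx (d + 1) m, p = hahnQ κ N α n} = orthSpace κ N n := by
  exact ⟨fun _ hα => hahnQ_eq_sum hκ hnm hmN hα, fun _ hν => hahnH_eq_sum hκ hnm hmN hν,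
    span_hahnQ hκ hnm hmN⟩
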